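/- All logarithms are to base $2$. A \emph{general arbitrarily varying wiretap channel} (GAVWC) $(\mathcal W^{G},\mathcal V^{G})$ consists, for each block length $n$, of finite alphabets $\mathcal X^{G,n},\mathcal Y^{G,n},\mathcal Z^{G,n}$, each a Cartesian product of $n$ nonempty finite sets and each with cardinality growing at most exponentially in $n$, of a nonempty (possibly infinite) set $\mathcal W^{G,n}$ of channels (stochastic matrices) $W(\mathbf y|\mathbf x)$ from $\mathcal X^{G,n}$ to $\mathcal Y^{G,n}$, and of a nonempty (possibly infinite) set $\mathcal V^{G,n}$ of channels $V(\mathbf z|\mathbf x)$ from $\mathcal X^{G,n}$ to $\mathcal Z^{G,n}$. A code of length $n$ consists of a finite nonempty message set $\mathcal U$, a random encoder, i.e. a stochastic matrix $\Phi(\mathbf x|u)$ from $\mathcal U$ to $\mathcal X^{G,n}$, and a deterministic decoder $\psi:\mathcal Y^{G,n}\to\mathcal U$; its rate is $\frac1n\log|\mathcal U|$. Write $W(\mathbf y|\Phi(u))=\sum_{\mathbf x}\Phi(\mathbf x|u)W(\mathbf y|\mathbf x)$, similarly $V(\mathbf z|\Phi(u))$, and let $e_W(u)=\sum_{\mathbf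 y:\psi(\mathbf y)\ne u}W(\mathbf y|\Phi(u))$ be the error probability of the message $u$. For a random message $U$ let $I(U;\mathbf Z(V))$ be the mutual information between $U$ and the output of $V$ when $U$ is encoded by $\Phi$. A number $R\ge 0$ is achievable by average error and strongly secure codes if for all $\epsilon,\lambda,\mu>0$ and all sufficiently large $n$ there is a code of length $n$ with rate larger than $R-\epsilon$ such that $\frac{1}{|\mathcal U|}\sum_u e_W(u)\le\lambda$ for all $W\in\mathcal W^{G,n}$ and $I(U;\mathbf Z(V))\le\mu$ for all $V\in\mathcal V^{G,n}$ and $U$ uniform on $\mathcal U$. It is achievable by maximum error and mutual-information (semantically) secure codes if the same holds with the requirements $e_W(u)\le\lambda$ for all $W\in\mathcal W^{G,n}$ and all $u\in\mathcal U$, and $I(U;\mathbf Z(V))\le\mu$ for all $V\in\mathcal V^{G,n}$ and all distributions of $U$ on $\mathcal U$. The capacities $C_{a\text{-}str}$ and $C_{m\text{-}mis}$ are the suprema of the rates achievable in the first and in the second sense. Let $v_n$ be the minimum (infimum) of the positive values of $V(\mathbf z|\mathbf x)$ over all $V\in\mathcal V^{G,n}$, $\mathbf x$, $\mathbf z$.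 By convention $\log\log 1=0$ and $\log\log\infty=\infty$ (with $v_n^{-1}=\infty$ if $v_n=0$). \textbf{Theorem.} For every GAVWC with $\limsup_{n\to\infty}\frac1n\log\log v_n^{-1}=0$, both capacities are finite and $$C_{a\text{-}str}-C_{m\text{-}mis}\le\max\Big\{\limsup_{n\to\infty}\frac1n\log\log|\mathcal W^{G,n}|,\ \limsup_{n\to\infty}\frac1n\log\log|\mathcal V^{G,n}|\Big\}.$$ The bound is the best possible: for every $a\in(0,1)$ consider the GAVWC with all alphabets equal to $\{0,1\}^n$, with $\mathcal W^{G,n}$ consisting of the noiseless channel only, and with $\mathcal V^{G,n}=\{V_\Theta:\Theta\subseteq\{0,1\}^n,\ |\Theta|=\lfloor 2^{na}\rfloor\}$, where for an input $\mathbf x\in\Theta$ the output of $V_\Theta$ is $\mathbf x$ with probability one and for an input $\mathbf x\notin\Theta$ the output is uniformly distributed on $\{0,1\}^n$. It satisfies $\limsup_{n\to\infty}\frac1n\log\log v_n^{-1}=0$, $C_{a\text{-}str}=1$, $C_{m\text{-}mis}=1-a$, and the right-hand side of the bound equals $a$, so the bound holds with equality. -/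

import Mathlib

open Filter Topology
open scoped ENNReal

noncomputable section

/-- A channel (stochastic matrix) with input alphabet `A` and finite output alphabet `B`:
`Q a b` is the probability of the output `b` when `a` is the input. -/
abbrev Channel (A B : Type) [Fintype B] : Type := A → stdSimplex ℝ B

/-- A general arbitrarily varying wiretap channel. For each block length `n` the input alphabet and
the two output alphabets are Cartesian products of `n` finite sets, whose cardinalities grow at most
exponentially in `n`; `main n` and `wiretap n` are the (arbitrary nonempty, possibly infinite) sets
of main channels and of wiretap channels from which the jammer chooses. -/
structure GAVWC where
  /-- the `i`-th factor of the input alphabet for block length `n` -/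
  X : (n : ℕ) → Fin n → Type
  /-- the `i`-th factor of the legitimate output alphabet for block length `n` -/
  Y : (n : ℕ) → Fin n → Type
  /-- the `i`-th factor of the eavesdropper's output alphabet for block length `n` -/
  Z : (n : ℕ) → Fin n → Type
  [fintypeX : ∀ n i, Fintype (X n i)]
  [fintypeY : ∀ n i, Fintype (Y n i)]
  [fintypeZ : ∀ n i, Fintype (Z n i)]
  [nonemptyX : ∀ n i, Nonempty (X n i)]
  [nonemptyY : ∀ n i, Nonempty (Y n i)]
  [nonemptyZ : ∀ n i, Nonempty (Z n i)]
  card_le : ∃ c : ℕ, ∀ n, Fintype.card (∀ i, X n i) ≤ c ^ n ∧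
    Fintype.card (∀ i, Y n i) ≤ c ^ n ∧ Fintype.card (∀ i, Z n i) ≤ c ^ n
  /-- the set of main channels -/
  main : (n : ℕ) → Set (Channel (∀ i, X n i) (∀ i, Y n i))
  /-- the set of wiretap channels -/
  wiretap : (n : ℕ) → Set (Channel (∀ i, X n i) (∀ i, Z n i))
  main_nonempty : ∀ n, (main n).Nonempty
  wiretap_nonempty : ∀ n, (wiretap n).Nonempty

attribute [instance] GAVWC.fintypeX GAVWC.fintypeY GAVWC.fintypeZ
  GAVWC.nonemptyX GAVWC.nonemptyY GAVWC.nonemptyZ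

/-- Output distribution of the channel `Q` for the message `u` and the random encoder `Φ`:
`Q(b | Φ(u)) = ∑ₓ Φ(x | u) Q(b | x)`. -/
def outputProb {U A B : Type} [Fintype A] [Fintype B] (Φ : Channel U A) (Q : Channel A B)
    (u : U) (b : B) : ℝ :=
  ∑ x, Φ u x * Q x b

/-- Mutual information (in bits) between an input with distribution `P` and the output of the
stochastic matrix `Q`:
`∑ᵤ P(u) ∑_b Q(b | u) log₂ (Q(b | u) / ∑ᵥ P(v) Q(b | v))`, with `0 log 0 = 0`. -/
def mutualInfo {U B : Type} [Fintype U] [Fintype B] (P : U → ℝ) (Q : U → B → ℝ) : ℝ :=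
  ∑ u, P u * ∑ b, Q u b * Real.logb 2 (Q u b / ∑ v, P v * Q v b)

namespace GAVWC

/-- A random encoding code of length `n`: a finite nonempty message set (which may be taken to be
`{0, …, M - 1}`), a random (stochastic) encoder and a deterministic decoder. -/
structure Code (G : GAVWC) (n : ℕ) where
  /-- the number of messages -/
  M : ℕ
  M_pos : 0 < M
  /-- the random encoder -/
  enc : Channel (Fin M) (∀ i, G.X n i)
  /-- the decoder -/
  dec : (∀ i, G.Y n i) → Fin M

namespace Code

variable {G : GAVWC} {n : ℕ}

/-- The rate `(1/n) log₂ M` of a code. -/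
def rate (c : G.Code n) : ℝ := Real.logb 2 c.M / n

open Classical in
/-- The error probability `W(ψ(Y) ≠ u | Φ(u))` for the message `u`. -/
def errorProb (c : G.Code n) (W : Channel (∀ i, G.X n i) (∀ i, G.Y n i)) (u : Fin c.M) : ℝ :=
  ∑ y with c.dec y ≠ u, outputProb c.enc W u y

/-- The mutual information `I(U; Z(V))` when the message `U` has distribution `P`. -/
def leakage (c : G.Code n) (V : Channel (∀ i, G.X n i) (∀ i, G.Z n i)) (P : Fin c.M → ℝ) : ℝ :=
  mutualInfo P (outputProb c.enc V)

/-- The average error probability is at most `l` for all main channels. -/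
def AverageError (c : G.Code n) (l : ℝ) : Prop :=
  ∀ W ∈ G.main n, ∑ u, (1 / (c.M : ℝ)) * c.errorProb W u ≤ l

/-- The maximal error probability is at most `l` for all main channels. -/
def MaximalError (c : G.Code n) (l : ℝ) : Prop :=
  ∀ W ∈ G.main n, ∀ u, c.errorProb W u ≤ l

/-- For the uniform message the leakage is at most `m` for all wiretap channels. -/
def StronglySecure (c : G.Code n) (m : ℝ) : Prop :=
  ∀ V ∈ G.wiretap n, c.leakage V (fun _ => 1 / (c.M : ℝ)) ≤ m

/-- For every distribution of the message the leakage is at most `m` for all wiretap channels. -/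
def MISecure (c : G.Code n) (m : ℝ) : Prop :=
  ∀ V ∈ G.wiretap n, ∀ P ∈ stdSimplex ℝ (Fin c.M), c.leakage V P ≤ m

end Code

/-- `R` is achievable by average error and strongly secure codes. -/
def AchievableStrong (G : GAVWC) (R : ℝ) : Prop :=
  0 ≤ R ∧ ∀ ε l m : ℝ, 0 < ε → 0 < l → 0 < m → ∀ᶠ n in atTop,
    ∃ c : G.Code n, R - ε < c.rate ∧ c.AverageError l ∧ c.StronglySecure m

/-- `R` is achievable by maximal error and mutual-information secure codes. -/
def AchievableMI (G : GAVWC) (R : ℝ) : Prop :=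
  0 ≤ R ∧ ∀ ε l m : ℝ, 0 < ε → 0 < l → 0 < m → ∀ᶠ n in atTop,
    ∃ c : G.Code n, R - ε < c.rate ∧ c.MaximalError l ∧ c.MISecure m

/-- The capacity for average error and strongly secure codes. -/
def capacityStrong (G : GAVWC) : EReal := ⨆ (R : ℝ) (_ : G.AchievableStrong R), (R : EReal)

/-- The capacity for maximal error and mutual-information (semantically) secure codes. -/
def capacityMI (G : GAVWC) : EReal := ⨆ (R : ℝ) (_ : G.AchievableMI R), (R : EReal)

/-- `vₙ`: the minimum (infimum, if there are infinitely many wiretap channels) of the positive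
values of `V(z | x)` over all wiretap channels `V` of block length `n`. -/
def minProb (G : GAVWC) (n : ℕ) : ℝ≥0∞ :=
  ⨅ (V ∈ G.wiretap n) (x : ∀ i, G.X n i) (z : ∀ i, G.Z n i) (_ : 0 < V x z), ENNReal.ofReal (V x z)

end GAVWC

/-- `log₂ log₂ t` for `t ∈ [1, ∞]`, with the conventions `log₂ log₂ 1 = 0` and
`log₂ log₂ ∞ = ∞`. -/
def logLog (t : ℝ≥0∞) : EReal :=
  if t = ⊤ then ⊤ else if t = 1 then 0 else ((Real.logb 2 (Real.logb 2 t.toReal) : ℝ) : EReal)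

/-- `limsup (1/n) log₂ log₂ tₙ`. -/
def doubleExpRate (t : ℕ → ℝ≥0∞) : EReal :=
  limsup (fun n : ℕ => logLog (t n) / (n : EReal)) atTop

namespace GAVWC

/-- `limsup (1/n) log₂ log₂ |𝒲ₙ|`. -/
def mainRate (G : GAVWC) : EReal := doubleExpRate fun n => ((G.main n).encard : ℝ≥0∞)

/-- `limsup (1/n) log₂ log₂ |𝒱ₙ|`. -/
def wiretapRate (G : GAVWC) : EReal := doubleExpRate fun n => ((G.wiretap n).encard : ℝ≥0∞)

/-- `limsup (1/n) log₂ log₂ vₙ⁻¹`. -/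
def minProbRate (G : GAVWC) : EReal := doubleExpRate fun n => (G.minProb n)⁻¹

end GAVWC

/-- The channel `V_Θ`, from a finite set `A` to itself: noiseless on inputs in `Θ`, and uniformly
distributed output for inputs outside `Θ`. -/
def subsetChannel {A : Type} [Fintype A] [Nonempty A] [DecidableEq A] (Θ : Finset A) :
    Channel A A :=
  fun x => if x ∈ Θ then stdSimplex.vertex x else stdSimplex.barycenter

theorem floor_two_rpow_le (a : ℝ) (ha : a < 1) (n : ℕ) : ⌊(2 : ℝ) ^ (n * a)⌋₊ ≤ 2 ^ n := by
  have h1 : (2 : ℝ) ^ (n * a) ≤ (2 : ℝ) ^ (n : ℝ) :=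
    Real.rpow_le_rpow_of_exponent_le (by norm_num)
      (mul_le_of_le_one_right (Nat.cast_nonneg n) ha.le)
  rw [Real.rpow_natCast] at h1
  have h2 := Nat.floor_mono h1
  have h3 : ⌊(2 : ℝ) ^ n⌋₊ = 2 ^ n := by
    have h := Nat.floor_natCast (R := ℝ) (2 ^ n)
    push_cast at h
    exact h
  rwa [h3] at h2

/-- The example: all alphabets are `{0,1}ⁿ`, the only main channel is noiseless, and the wiretap
channels are the channels `V_Θ` with `Θ ⊆ {0,1}ⁿ` of cardinality `⌊2^(na)⌋`. -/
def subsetGAVWC (a : ℝ) (ha : a < 1) : GAVWC where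
  X _ _ := Bool
  Y _ _ := Bool
  Z _ _ := Bool
  card_le := ⟨2, fun n => by simp⟩
  main _ := {fun x => stdSimplex.vertex x}
  wiretap n := {V | ∃ Θ : Finset (Fin n → Bool), Θ.card = ⌊(2 : ℝ) ^ (n * a)⌋₊ ∧
    V = subsetChannel Θ}
  main_nonempty _ := Set.singleton_nonempty _
  wiretap_nonempty n := by
    obtain ⟨Θ, -, hΘ⟩ := Finset.exists_subset_card_eq (s := (Finset.univ : Finset (Fin n → Bool)))
      (n := ⌊(2 : ℝ) ^ (n * a)⌋₊) (by simpa using floor_two_rpow_le a ha n)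
    exact ⟨_, Θ, hΘ, rfl⟩

end

/-! The bound on the capacities comes from random binning. Take an average-error, strongly secure
code with `M ≈ 2^(nR)` messages and throw its messages independently and uniformly into `m ≈
2^(n(R-s))` bins. The new code sends a uniformly chosen element of the bin. For each main channel
the error probability, and for each wiretap channel the relative entropy of the output to the mean
output, is a bounded function of the old message with small mean over all messages. The relative
entropy is at most `log₂ M`, since each output distribution is at most `M` times the uniform
mixture.

By an exponential moment bound, such a function averages to more than twice its allowed mean over a
given bin only with probability `exp(-c M / (m n))`, which is doubly exponentially small with
exponent larger than `s`. If there are at most `2^(2^(ns))` channels, a union bound leaves a binning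
good for all channels and all bins at once (`exists_binning`, `union_bound_lt_one`). Small error in
every bin is maximal error. Small relative entropy in every bin, to a reference that does not depend
on the bin, bounds the leakage for every message distribution (`leakage_binned_le`). Hence
`achievableMI_sub`.

In the example, uncoded transmission is error-free and leaks little for the uniform message, because
almost all inputs lie outside `Θ` (`mutualInfo_subsetChannel_le`). Conversely, with noticeably more
than `2^(n(1-a))` messages, two of them have decoding sets that fit together into some `Θ`, so the
eavesdropper can tell them apart (`not_miSecure_of_maximalError`). The matching lower bound on the
semantic capacity is the general inequality itself. -/

noncomputable section

/-! ### Relative entropy and mutual information -/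

/-- Relative entropy (in bits) of two nonnegative functions on a finite set. -/
def relEntropy {B : Type} [Fintype B] (p q : B → ℝ) : ℝ :=
  ∑ b, p b * Real.logb 2 (p b / q b)

/-- The tangent-line bound `p log₂ (p / q) ≥ (p (1 + ln t) - t q) / ln 2`. -/
theorem tangent_le_mul_logb_div {p q t : ℝ} (hp : 0 ≤ p) (hq : 0 ≤ q) (ht : 0 < t)
    (hpq : q = 0 → p = 0) :
    (p * (1 + Real.log t) - t * q) / Real.log 2 ≤ p * Real.logb 2 (p / q) := by
  have h2 : 0 < Real.log 2 := Real.log_pos (by norm_num)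
  rw [Real.logb, ← mul_div_assoc]
  refine div_le_div_of_nonneg_right ?_ h2.le
  rcases hp.eq_or_lt with rfl | hp
  · simpa using mul_nonneg ht.le hq
  have hq : 0 < q := hq.lt_of_ne fun h => hp.ne' (hpq h.symm)
  -- `ln x ≤ x - 1` at `x = t q / p`; `t` is the slope left free for later choice.
  have h := Real.log_le_sub_one_of_pos (show 0 < t * q / p by positivity)
  rw [Real.log_div (by positivity) hp.ne', Real.log_mul ht.ne' hq.ne'] at h
  rw [Real.log_div hp.ne' hq.ne']
  have h3 := mul_le_mul_of_nonneg_left h hp.le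
  have h4 : p * (t * q / p - 1) = t * q - p := by field_simp
  linarith

/-- The tangent bound at `t = 1` sums to `(∑ p - ∑ q) / ln 2`, so only an inequality between the
total masses is needed. -/
theorem relEntropy_nonneg {B : Type} [Fintype B] {p q : B → ℝ} (hp : ∀ b, 0 ≤ p b)
    (hq : ∀ b, 0 ≤ q b) (hpq : ∀ b, q b = 0 → p b = 0) (hsum : ∑ b, q b ≤ ∑ b, p b) :
    0 ≤ relEntropy p q := by
  have h2 : 0 < Real.log 2 := Real.log_pos (by norm_num)
  calc 0 ≤ ∑ b, (p b * (1 + Real.log 1) - 1 * q b) / Real.log 2 := by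
        rw [← Finset.sum_div]
        refine div_nonneg ?_ h2.le
        simpa using hsum
    _ ≤ relEntropy p q :=
      Finset.sum_le_sum fun b _ => tangent_le_mul_logb_div (hp b) (hq b) one_pos (hpq b)

theorem mutualInfo_eq_sum_relEntropy {U B : Type} [Fintype U] [Fintype B] (P : U → ℝ)
    (Q : U → B → ℝ) :
    mutualInfo P Q = ∑ u, P u * relEntropy (Q u) fun b => ∑ v, P v * Q v b := rfl

/-- The compensation identity for relative entropies. -/
theorem sum_relEntropy_eq {U B : Type} [Fintype U] [Fintype B] {P : U → ℝ} {Q : U → B → ℝ}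
    {q : B → ℝ} (hP : ∀ u, 0 ≤ P u) (hQ : ∀ u b, 0 ≤ Q u b)
    (hq : ∀ u b, q b = 0 → Q u b = 0) :
    ∑ u, P u * relEntropy (Q u) q =
      mutualInfo P Q + relEntropy (fun b => ∑ u, P u * Q u b) q := by
  simp only [mutualInfo, relEntropy, Finset.sum_mul, Finset.mul_sum]
  rw [Finset.sum_comm (s := (Finset.univ : Finset B)), ← Finset.sum_add_distrib]
  refine Finset.sum_congr rfl fun u _ => ?_
  rw [← Finset.sum_add_distrib]
  refine Finset.sum_congr rfl fun b _ => ?_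
  by_cases h : P u * Q u b = 0
  · rcases mul_eq_zero.1 h with h | h <;> simp [h]
  have hm : ∑ v, P v * Q v b ≠ 0 := fun h0 =>
    h ((Finset.sum_eq_zero_iff_of_nonneg fun v _ => mul_nonneg (hP v) (hQ v b)).1 h0 u
      (Finset.mem_univ u))
  have hQu : Q u b ≠ 0 := right_ne_zero_of_mul h
  have hqb : q b ≠ 0 := fun h0 => hQu (hq u b h0)
  rw [Real.logb_div hQu hqb, Real.logb_div hQu hm, Real.logb_div hm hqb]
  ring

theorem sum_mixture {U B : Type} [Fintype U] [Fintype B] {P : U → ℝ} {Q : U → B → ℝ}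
    (hP : ∑ u, P u = 1) (hQ : ∀ u, ∑ b, Q u b = 1) : ∑ b, ∑ u, P u * Q u b = 1 := by
  rw [Finset.sum_comm]
  simp [← Finset.mul_sum, hQ, hP]

theorem mutualInfo_nonneg {U B : Type} [Fintype U] [Fintype B] {P : U → ℝ} {Q : U → B → ℝ}
    (hP : ∀ u, 0 ≤ P u) (hP1 : ∑ u, P u = 1) (hQ : ∀ u b, 0 ≤ Q u b)
    (hQ1 : ∀ u, ∑ b, Q u b = 1) : 0 ≤ mutualInfo P Q := by
  rw [mutualInfo_eq_sum_relEntropy]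
  refine Finset.sum_nonneg fun u _ => ?_
  rcases (hP u).eq_or_lt with h | h
  · simp [← h]
  refine mul_nonneg h.le (relEntropy_nonneg (hQ u)
    (fun b => Finset.sum_nonneg fun v _ => mul_nonneg (hP v) (hQ v b)) (fun b hb => ?_) ?_)
  · have := (Finset.sum_eq_zero_iff_of_nonneg fun v _ => mul_nonneg (hP v) (hQ v b)).1 hb u
      (Finset.mem_univ u)
    exact (mul_eq_zero.1 this).resolve_left h.ne'
  · rw [hQ1, sum_mixture hP1 hQ1]

/-- The mutual information is at most the mean relative entropy to any output distribution. -/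
theorem mutualInfo_le_sum_relEntropy {U B : Type} [Fintype U] [Fintype B] {P : U → ℝ}
    {Q : U → B → ℝ} {q : B → ℝ} (hP : ∀ u, 0 ≤ P u) (hP1 : ∑ u, P u = 1)
    (hQ : ∀ u b, 0 ≤ Q u b) (hQ1 : ∀ u, ∑ b, Q u b = 1) (hq0 : ∀ b, 0 ≤ q b)
    (hq1 : ∑ b, q b = 1) (hq : ∀ u b, q b = 0 → Q u b = 0) :
    mutualInfo P Q ≤ ∑ u, P u * relEntropy (Q u) q := by
  rw [sum_relEntropy_eq hP hQ hq]
  have : 0 ≤ relEntropy (fun b => ∑ u, P u * Q u b) q := by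
    refine relEntropy_nonneg (fun b => Finset.sum_nonneg fun v _ => mul_nonneg (hP v) (hQ v b))
      hq0 (fun b hb => ?_) ?_
    · simp [hq _ b hb]
    · rw [hq1, sum_mixture hP1 hQ1]
  linarith

/-- Convexity of the relative entropy in its first argument. -/
theorem relEntropy_mixture_le {U B : Type} [Fintype U] [Fintype B] {P : U → ℝ}
    {Q : U → B → ℝ} {q : B → ℝ} (hP : ∀ u, 0 ≤ P u) (hP1 : ∑ u, P u = 1)
    (hQ : ∀ u b, 0 ≤ Q u b) (hQ1 : ∀ u, ∑ b, Q u b = 1)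
    (hq : ∀ u b, q b = 0 → Q u b = 0) :
    relEntropy (fun b => ∑ u, P u * Q u b) q ≤ ∑ u, P u * relEntropy (Q u) q := by
  rw [sum_relEntropy_eq hP hQ hq]
  linarith [mutualInfo_nonneg hP hP1 hQ hQ1]

/-- If `p ≤ K q` for a probability vector `p`, then `D(p ‖ q) ≤ log₂ K`. -/
theorem relEntropy_le_logb {B : Type} [Fintype B] {p q : B → ℝ} {K : ℝ} (hp : ∀ b, 0 ≤ p b)
    (hp1 : ∑ b, p b = 1) (hq : ∀ b, 0 ≤ q b) (h : ∀ b, p b ≤ K * q b) :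
    relEntropy p q ≤ Real.logb 2 K := by
  calc relEntropy p q ≤ ∑ b, p b * Real.logb 2 K := by
        refine Finset.sum_le_sum fun b _ => ?_
        rcases (hp b).eq_or_lt with h0 | h0
        · simp [← h0]
        have hqb : 0 < q b := (hq b).lt_of_ne fun hb => by
          have := h b
          rw [← hb, mul_zero] at this
          linarith
        refine mul_le_mul_of_nonneg_left ?_ h0.le
        exact Real.logb_le_logb_of_le (by norm_num) (div_pos h0 hqb) ((div_le_iff₀ hqb).2 (h b))
    _ = Real.logb 2 K := by rw [← Finset.sum_mul, hp1, one_mul]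

theorem outputProb_nonneg {U A B : Type} [Fintype A] [Fintype B] (Φ : Channel U A)
    (Q : Channel A B) (u : U) (b : B) : 0 ≤ outputProb Φ Q u b :=
  Finset.sum_nonneg fun x _ => mul_nonneg (stdSimplex.zero_le (Φ u) x) (stdSimplex.zero_le (Q x) b)

theorem sum_outputProb {U A B : Type} [Fintype A] [Fintype B] (Φ : Channel U A)
    (Q : Channel A B) (u : U) : ∑ b, outputProb Φ Q u b = 1 :=
  sum_mixture (P := fun x => Φ u x) (Q := fun x b => Q x b) (stdSimplex.sum_eq_one (Φ u))
    fun x => stdSimplex.sum_eq_one (Q x)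

theorem outputProb_le_one {U A B : Type} [Fintype A] [Fintype B] (Φ : Channel U A)
    (Q : Channel A B) (u : U) (b : B) : outputProb Φ Q u b ≤ 1 := by
  rw [← sum_outputProb Φ Q u]
  exact Finset.single_le_sum (fun b _ => outputProb_nonneg Φ Q u b) (Finset.mem_univ b)

/-! ### Random binning -/

/-- Random binning: functions with small means have small means on every bin of some binning. -/
theorem exists_binning {U J ι : Type} [Fintype U] [Fintype J] [Fintype ι] [DecidableEq J]
    [Nonempty J] (g : ι → U → ℝ) (lam : ι → ℝ) (lam0 : ℝ) (hg0 : ∀ i u, 0 ≤ g i u)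
    (hg1 : ∀ i u, g i u ≤ 1) (hlam0 : 0 < lam0) (hlam : ∀ i, lam0 ≤ lam i) (hlam1 : ∀ i, lam i ≤ 1)
    (hmean : ∀ i, ∑ u, g i u ≤ Fintype.card U * lam i)
    (hsmall : Fintype.card ι * Fintype.card J *
      Real.exp (-(Fintype.card U / Fintype.card J * (lam0 / 12))) < 1) :
    ∃ f : U → J, ∀ i j, ∑ u with f u = j, (g i u - 2 * lam i) < 0 := by
  classical
  -- First-moment argument over all maps `f`: if each had a bad pair `(i, j)`, the sum over `f`,
  -- `i`, `j` of the exponentials would be at least the number of maps, against `hsmall`.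
  by_contra! hcon
  set N : ℝ := (Fintype.card J : ℝ) with hN
  set M : ℝ := (Fintype.card U : ℝ) with hM
  have hNpos : 0 < N := by rw [hN]; exact_mod_cast Fintype.card_pos
  have hM0 : 0 ≤ M := by rw [hM]; positivity
  -- Chord bound `e^g ≤ 1 + (e - 1) g` on `[0, 1]`, with `e - 1 < 7/4`.
  have hexp : ∀ i u, Real.exp (g i u - 2 * lam i) ≤
      Real.exp (-(2 * lam i)) * (1 + 7 / 4 * g i u) := by
    intro i u
    rw [sub_eq_neg_add, Real.exp_add]
    refine mul_le_mul_of_nonneg_left ?_ (Real.exp_pos _).le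
    have hconv := convexOn_exp.2 (Set.mem_univ 0) (Set.mem_univ 1)
      (sub_nonneg.2 (hg1 i u)) (hg0 i u) (by ring)
    simp only [smul_eq_mul, mul_zero, mul_one, zero_add, Real.exp_zero] at hconv
    nlinarith [Real.exp_one_lt_d9, hg0 i u]
  have hsumexp : ∀ i, ∑ u, (Real.exp (g i u - 2 * lam i) - 1) ≤ -(M * (lam0 / 12)) := by
    intro i
    have hl : 0 < lam i := hlam0.trans_le (hlam i)
    have h1 : ∑ u, Real.exp (g i u - 2 * lam i) ≤
        Real.exp (-(2 * lam i)) * (M * (1 + 7 / 4 * lam i)) := by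
      refine (Finset.sum_le_sum fun u _ => hexp i u).trans ?_
      rw [← Finset.mul_sum]
      refine mul_le_mul_of_nonneg_left ?_ (Real.exp_pos _).le
      rw [Finset.sum_add_distrib, ← Finset.mul_sum]
      simp only [Finset.sum_const, Finset.card_univ, nsmul_eq_mul, mul_one]
      linarith [hmean i]
    have h2 : Real.exp (-(2 * lam i)) ≤ 1 / (1 + 2 * lam i) := by
      rw [Real.exp_neg, ← one_div]
      refine one_div_le_one_div_of_le (by positivity) ?_
      linarith [Real.add_one_le_exp (2 * lam i)]
    -- The quotient `(1 + 7λ/4) / (1 + 2λ)` is `1 - (λ/4) / (1 + 2λ)`, and `1 + 2λ ≤ 3`; hence the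
    -- `12`.
    have h3 : Real.exp (-(2 * lam i)) * (1 + 7 / 4 * lam i) ≤ 1 - lam0 / 12 := by
      refine (mul_le_mul_of_nonneg_right h2 (by positivity)).trans ?_
      rw [one_div, inv_mul_le_iff₀ (by positivity)]
      nlinarith [hlam i, hlam1 i]
    rw [Finset.sum_sub_distrib]
    simp only [Finset.sum_const, Finset.card_univ, nsmul_eq_mul, mul_one]
    have h4 := mul_le_mul_of_nonneg_left h3 hM0
    rw [← hM]
    nlinarith
  -- The bins of different messages are independent, so the sum over maps factorises; then `1 + x ≤
  -- e^x` in each factor.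
  have hprod : ∀ i (j : J), ∑ f : U → J, Real.exp (∑ u with f u = j, (g i u - 2 * lam i)) ≤
      N ^ Fintype.card U * Real.exp (-(M / N * (lam0 / 12))) := by
    intro i j
    calc ∑ f : U → J, Real.exp (∑ u with f u = j, (g i u - 2 * lam i))
        = ∑ f : U → J, ∏ u, (if f u = j then Real.exp (g i u - 2 * lam i) else 1) := by
          refine Finset.sum_congr rfl fun f _ => ?_
          rw [Finset.sum_filter, Real.exp_sum]
          refine Finset.prod_congr rfl fun u _ => ?_
          split_ifs <;> simp
      _ = ∏ u, ∑ k, (if k = j then Real.exp (g i u - 2 * lam i) else 1) :=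
          (Fintype.prod_sum fun u k => if k = j then Real.exp (g i u - 2 * lam i) else 1).symm
      _ = ∏ u, (N * (1 + (Real.exp (g i u - 2 * lam i) - 1) / N)) := by
          refine Finset.prod_congr rfl fun u _ => ?_
          have : ∀ k, (if k = j then Real.exp (g i u - 2 * lam i) else 1) =
              1 + (if k = j then (Real.exp (g i u - 2 * lam i) - 1) else 0) := by
            intro k; split_ifs <;> ring
          simp only [this, Finset.sum_add_distrib, Finset.sum_ite_eq', Finset.mem_univ, if_true]
          simp only [Finset.sum_const, Finset.card_univ, nsmul_eq_mul, mul_one]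
          rw [← hN]; field_simp
      _ ≤ ∏ u, (N * Real.exp ((Real.exp (g i u - 2 * lam i) - 1) / N)) := by
          refine Finset.prod_le_prod (fun u _ => ?_) fun u _ => ?_
          · have h1 : 1 ≤ N := by
              rw [hN]; exact_mod_cast Fintype.card_pos
            have h2 := Real.exp_pos (g i u - 2 * lam i)
            have : N * (1 + (Real.exp (g i u - 2 * lam i) - 1) / N) =
              (N - 1) + Real.exp (g i u - 2 * lam i) := by field_simp; ring
            linarith
          · refine mul_le_mul_of_nonneg_left ?_ hNpos.le
            rw [add_comm]; exact Real.add_one_le_exp _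
      _ = N ^ Fintype.card U * Real.exp ((∑ u, (Real.exp (g i u - 2 * lam i) - 1)) / N) := by
          rw [Finset.prod_mul_distrib, Finset.prod_const, ← Real.exp_sum, Finset.sum_div,
            Finset.card_univ]
      _ ≤ _ := by
          refine mul_le_mul_of_nonneg_left (Real.exp_le_exp.2 ?_) (by positivity)
          rw [div_le_iff₀ hNpos]
          refine (hsumexp i).trans (le_of_eq ?_)
          field_simp
  have hcount : N ^ Fintype.card U ≤
      ∑ f : U → J, ∑ i, ∑ j, Real.exp (∑ u with f u = j, (g i u - 2 * lam i)) := by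
    calc N ^ Fintype.card U = ∑ f : U → J, (1 : ℝ) := by simp [hN]
      _ ≤ _ := by
        refine Finset.sum_le_sum fun f _ => ?_
        obtain ⟨i, j, hij⟩ := hcon f
        calc (1 : ℝ) ≤ Real.exp (∑ u with f u = j, (g i u - 2 * lam i)) := Real.one_le_exp hij
          _ ≤ ∑ j, Real.exp (∑ u with f u = j, (g i u - 2 * lam i)) :=
            Finset.single_le_sum
              (f := fun j => Real.exp (∑ u with f u = j, (g i u - 2 * lam i)))
              (fun _ _ => (Real.exp_pos _).le) (Finset.mem_univ j)
          _ ≤ _ := Finset.single_le_sum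
              (f := fun i => ∑ j, Real.exp (∑ u with f u = j, (g i u - 2 * lam i)))
              (fun _ _ => Finset.sum_nonneg fun _ _ => (Real.exp_pos _).le) (Finset.mem_univ i)
  have htotal : N ^ Fintype.card U ≤
      N ^ Fintype.card U * (Fintype.card ι * N * Real.exp (-(M / N * (lam0 / 12)))) := by
    refine hcount.trans ?_
    rw [Finset.sum_comm]
    calc ∑ i, ∑ f : U → J, ∑ j, Real.exp (∑ u with f u = j, (g i u - 2 * lam i))
        = ∑ i, ∑ j : J, ∑ f : U → J, Real.exp (∑ u with f u = j, (g i u - 2 * lam i)) :=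
          Finset.sum_congr rfl fun i _ => Finset.sum_comm
      _ ≤ ∑ i : ι, ∑ j : J, N ^ Fintype.card U * Real.exp (-(M / N * (lam0 / 12))) :=
          Finset.sum_le_sum fun i _ => Finset.sum_le_sum fun j _ => hprod i j
      _ = _ := by
          simp only [Finset.sum_const, Finset.card_univ, nsmul_eq_mul]
          rw [← hN]; ring
  have hpow : 0 < N ^ Fintype.card U := by positivity
  nlinarith

/-! ### Binned codes and the passage to maximal error and semantic security -/

/-- The uniform distribution on the fibre of `f` over `j`. -/
def fiberWeight {U J : Type} [Fintype U] [DecidableEq J] (f : U → J) (j : J) (u : U) : ℝ :=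
  if f u = j then 1 / ((Finset.univ.filter fun v => f v = j).card : ℝ) else 0

section fiberWeight

variable {U J : Type} [Fintype U] [DecidableEq J] {f : U → J}

theorem fiberWeight_nonneg (f : U → J) (j : J) (u : U) : 0 ≤ fiberWeight f j u := by
  unfold fiberWeight
  split_ifs <;> positivity

theorem card_fiber_pos (hf : Function.Surjective f) (j : J) :
    0 < ((Finset.univ.filter fun v => f v = j).card : ℝ) := by
  obtain ⟨u, hu⟩ := hf j
  exact_mod_cast Finset.card_pos.2 ⟨u, by simp [hu]⟩

theorem sum_fiberWeight_mul (f : U → J) (j : J) (g : U → ℝ) :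
    ∑ u, fiberWeight f j u * g u =
      (∑ u with f u = j, g u) / ((Finset.univ.filter fun v => f v = j).card : ℝ) := by
  rw [Finset.sum_filter, Finset.sum_div]
  refine Finset.sum_congr rfl fun u _ => ?_
  unfold fiberWeight
  split_ifs <;> ring

theorem sum_fiberWeight (hf : Function.Surjective f) (j : J) : ∑ u, fiberWeight f j u = 1 := by
  have h := sum_fiberWeight_mul f j fun _ => 1
  simp only [mul_one, Finset.sum_const, nsmul_eq_mul] at h
  rw [h, div_self (card_fiber_pos hf j).ne']

theorem sum_fiberWeight_mul_le (hf : Function.Surjective f) {j : J} {g : U → ℝ} {t : ℝ}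
    (h : ∑ u with f u = j, (g u - t) ≤ 0) : ∑ u, fiberWeight f j u * g u ≤ t := by
  rw [sum_fiberWeight_mul, div_le_iff₀ (card_fiber_pos hf j)]
  rw [Finset.sum_sub_distrib, Finset.sum_const, nsmul_eq_mul] at h
  linarith

end fiberWeight

namespace GAVWC.Code

variable {G : GAVWC} {n : ℕ}

theorem errorProb_nonneg (c : G.Code n) (W : Channel (∀ i, G.X n i) (∀ i, G.Y n i))
    (u : Fin c.M) : 0 ≤ c.errorProb W u :=
  Finset.sum_nonneg fun y _ => outputProb_nonneg _ _ _ y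

theorem errorProb_le_one (c : G.Code n) (W : Channel (∀ i, G.X n i) (∀ i, G.Y n i))
    (u : Fin c.M) : c.errorProb W u ≤ 1 := by
  rw [← sum_outputProb c.enc W u]
  exact Finset.sum_le_sum_of_subset_of_nonneg (Finset.subset_univ _)
    fun y _ _ => outputProb_nonneg _ _ _ y

theorem errorProb_eq_sum_ite (c : G.Code n) (W : Channel (∀ i, G.X n i) (∀ i, G.Y n i))
    (u : Fin c.M) :
    c.errorProb W u = ∑ y, if c.dec y = u then 0 else outputProb c.enc W u y := by
  unfold errorProb
  rw [Finset.sum_filter]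
  simp only [ne_eq, ite_not]

/-- The code which transmits a uniformly distributed element of the bin `f ⁻¹ {j}` for the
message `j`. -/
abbrev binned (c : G.Code n) {m : ℕ} (hm : 0 < m) (f : Fin c.M → Fin m)
    (hf : Function.Surjective f) : G.Code n where
  M := m
  M_pos := hm
  enc j := ⟨fun x => ∑ u, fiberWeight f j u * c.enc u x,
    fun x => Finset.sum_nonneg fun u _ =>
      mul_nonneg (fiberWeight_nonneg f j u) (stdSimplex.zero_le (c.enc u) x),
    sum_mixture (Q := fun u x => c.enc u x) (sum_fiberWeight hf j)
      fun u => stdSimplex.sum_eq_one (c.enc u)⟩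
  dec y := f (c.dec y)

section binned

variable (c : G.Code n) {m : ℕ} (hm : 0 < m) (f : Fin c.M → Fin m) (hf : Function.Surjective f)

theorem outputProb_binned {B : Type} [Fintype B] (Q : Channel (∀ i, G.X n i) B) (j : Fin m)
    (b : B) : outputProb (c.binned hm f hf).enc Q j b =
      ∑ u, fiberWeight f j u * outputProb c.enc Q u b := by
  change ∑ x, (∑ u, fiberWeight f j u * c.enc u x) * Q x b = _
  simp only [outputProb, Finset.sum_mul, Finset.mul_sum]
  rw [Finset.sum_comm]
  simp only [mul_assoc]

/-- Decoding into the wrong bin implies decoding to the wrong original message. -/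
theorem errorProb_binned_le (W : Channel (∀ i, G.X n i) (∀ i, G.Y n i)) (j : Fin m) :
    (c.binned hm f hf).errorProb W j ≤ ∑ u, fiberWeight f j u * c.errorProb W u := by
  have h : (c.binned hm f hf).errorProb W j =
      ∑ u, fiberWeight f j u * ∑ y with f (c.dec y) ≠ j, outputProb c.enc W u y := by
    rw [errorProb_eq_sum_ite]
    simp only [Finset.mul_sum]
    simp only [Finset.sum_filter, ne_eq, ite_not]
    rw [Finset.sum_comm]
    refine Finset.sum_congr rfl fun y _ => ?_
    rw [outputProb_binned c hm f hf]
    by_cases hy : f (c.dec y) = j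
    · rw [if_pos (show (c.binned hm f hf).dec y = j from hy)]
      simp [hy]
    · rw [if_neg (show ¬ (c.binned hm f hf).dec y = j from hy)]
      simp [hy]
  rw [h]
  refine Finset.sum_le_sum fun u _ => ?_
  by_cases hu : f u = j
  · refine mul_le_mul_of_nonneg_left ?_ (fiberWeight_nonneg f j u)
    unfold errorProb
    refine Finset.sum_le_sum_of_subset_of_nonneg (fun y hy => ?_)
      fun y _ _ => outputProb_nonneg _ _ _ y
    simp only [Finset.mem_filter, Finset.mem_univ, true_and] at hy ⊢
    exact fun h => hy (by rw [h, hu])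
  · simp [fiberWeight, hu]

/-- Mean output distribution for the uniformly distributed message. -/
def meanOutput (V : Channel (∀ i, G.X n i) (∀ i, G.Z n i)) (z : ∀ i, G.Z n i) : ℝ :=
  ∑ u : Fin c.M, 1 / (c.M : ℝ) * outputProb c.enc V u z

theorem M_pos' : 0 < (c.M : ℝ) := Nat.cast_pos.2 c.M_pos

theorem sum_uniform : ∑ _u : Fin c.M, 1 / (c.M : ℝ) = 1 := by
  simp [c.M_pos.ne']

theorem uniform_mem : (fun _ : Fin c.M => 1 / (c.M : ℝ)) ∈ stdSimplex ℝ (Fin c.M) :=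
  ⟨fun _ => one_div_nonneg.2 c.M_pos'.le, c.sum_uniform⟩

theorem meanOutput_nonneg (V : Channel (∀ i, G.X n i) (∀ i, G.Z n i)) (z : ∀ i, G.Z n i) :
    0 ≤ c.meanOutput V z :=
  Finset.sum_nonneg fun _ _ =>
    mul_nonneg (one_div_nonneg.2 c.M_pos'.le) (outputProb_nonneg _ _ _ z)

theorem sum_meanOutput (V : Channel (∀ i, G.X n i) (∀ i, G.Z n i)) :
    ∑ z, c.meanOutput V z = 1 :=
  sum_mixture c.sum_uniform fun u => sum_outputProb c.enc V u

/-- One term of a uniform mixture of `M` nonnegative terms. This gives both the absolute continuity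
and the bound `log₂ M` on the divergence. -/
theorem outputProb_le_meanOutput (V : Channel (∀ i, G.X n i) (∀ i, G.Z n i)) (u : Fin c.M)
    (z : ∀ i, G.Z n i) : outputProb c.enc V u z ≤ c.M * c.meanOutput V z := by
  have h := c.M_pos'
  rw [meanOutput, ← Finset.mul_sum, ← mul_assoc, mul_one_div_cancel h.ne', one_mul]
  exact Finset.single_le_sum (fun u _ => outputProb_nonneg c.enc V u z) (Finset.mem_univ u)

theorem outputProb_eq_zero_of_meanOutput (V : Channel (∀ i, G.X n i) (∀ i, G.Z n i))
    (u : Fin c.M) (z : ∀ i, G.Z n i) (h : c.meanOutput V z = 0) :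
    outputProb c.enc V u z = 0 := by
  have := c.outputProb_le_meanOutput V u z
  rw [h, mul_zero] at this
  exact le_antisymm this (outputProb_nonneg _ _ _ _)

/-- Relative entropy between the output distribution for the message `u` and the mean output
distribution. -/
def divergence (V : Channel (∀ i, G.X n i) (∀ i, G.Z n i)) (u : Fin c.M) : ℝ :=
  relEntropy (outputProb c.enc V u) (c.meanOutput V)

theorem leakage_uniform (V : Channel (∀ i, G.X n i) (∀ i, G.Z n i)) :
    c.leakage V (fun _ => 1 / (c.M : ℝ)) = ∑ u, 1 / (c.M : ℝ) * c.divergence V u := rfl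

theorem divergence_nonneg (V : Channel (∀ i, G.X n i) (∀ i, G.Z n i)) (u : Fin c.M) :
    0 ≤ c.divergence V u :=
  relEntropy_nonneg (outputProb_nonneg _ _ _) (c.meanOutput_nonneg V)
    (c.outputProb_eq_zero_of_meanOutput V u) (by rw [sum_meanOutput, sum_outputProb])

theorem divergence_le (V : Channel (∀ i, G.X n i) (∀ i, G.Z n i)) (u : Fin c.M) :
    c.divergence V u ≤ Real.logb 2 c.M :=
  relEntropy_le_logb (outputProb_nonneg _ _ _) (sum_outputProb _ _ _) (c.meanOutput_nonneg V)
    (c.outputProb_le_meanOutput V u)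

/-- The mean output of the original code serves as reference distribution for any `P`: replacing the
true output mixture by it only increases the mean relative entropy, and convexity then reduces each
bin to the average over its elements. -/
theorem leakage_binned_le (V : Channel (∀ i, G.X n i) (∀ i, G.Z n i)) {t : ℝ}
    (h : ∀ j, ∑ u, fiberWeight f j u * c.divergence V u ≤ t) {P : Fin m → ℝ}
    (hP : P ∈ stdSimplex ℝ (Fin m)) : (c.binned hm f hf).leakage V P ≤ t := by
  have hsupp : ∀ (j : Fin m) z, c.meanOutput V z = 0 →
      outputProb (c.binned hm f hf).enc V j z = 0 := by
    intro j z hz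
    rw [outputProb_binned]
    simp [c.outputProb_eq_zero_of_meanOutput V _ z hz]
  calc (c.binned hm f hf).leakage V P
      ≤ ∑ j, P j * relEntropy (outputProb (c.binned hm f hf).enc V j) (c.meanOutput V) :=
        mutualInfo_le_sum_relEntropy (U := Fin m) hP.1 hP.2 (outputProb_nonneg _ _)
          (sum_outputProb _ _) (c.meanOutput_nonneg V) (c.sum_meanOutput V) hsupp
    _ ≤ ∑ j, P j * t := by
        refine Finset.sum_le_sum fun j _ => mul_le_mul_of_nonneg_left ?_ (hP.1 j)
        refine le_trans ?_ (h j)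
        have : outputProb (c.binned hm f hf).enc V j =
            fun z => ∑ u, fiberWeight f j u * outputProb c.enc V u z :=
          funext fun z => outputProb_binned c hm f hf V j z
        rw [this]
        exact relEntropy_mixture_le (fiberWeight_nonneg f j) (sum_fiberWeight hf j)
          (outputProb_nonneg _ _) (sum_outputProb _ _) (c.outputProb_eq_zero_of_meanOutput V)
    _ = t := by rw [← Finset.sum_mul, hP.2, one_mul]

end binned

/-- From average to maximal error and from strong to semantic security by random binning. -/
theorem exists_maximalError_miSecure (c : G.Code n) {m : ℕ} (hm : 0 < m) {l μ K lam0 : ℝ}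
    (hW : (G.main n).Finite) (hV : (G.wiretap n).Finite) (hl : c.AverageError l)
    (hμ : c.StronglySecure μ) (hK : Real.logb 2 c.M ≤ K) (hK0 : 0 < K) (hlam0 : 0 < lam0)
    (hll : lam0 ≤ l) (hl1 : l ≤ 1) (hlμ : lam0 ≤ μ / K) (hμ1 : μ / K ≤ 1)
    (hsmall : ((G.main n).ncard + (G.wiretap n).ncard : ℝ) * m *
      Real.exp (-(c.M / m * (lam0 / 12))) < 1) :
    ∃ c' : G.Code n, c'.M = m ∧ c'.MaximalError (2 * l) ∧ c'.MISecure (2 * μ) := by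
  have := hW.fintype
  have := hV.fintype
  have : Nonempty (Fin m) := ⟨⟨0, hm⟩⟩
  have hM := c.M_pos'
  -- Both kinds of requirement are treated as one family; division by `K ≥ log₂ M` brings the
  -- divergences into `[0, 1]`.
  obtain ⟨f, hf⟩ := exists_binning (U := Fin c.M) (J := Fin m)
    (ι := G.main n ⊕ G.wiretap n)
    (Sum.elim (fun W u => c.errorProb W.1 u) (fun V u => c.divergence V.1 u / K))
    (Sum.elim (fun _ => l) (fun _ => μ / K)) lam0
    (by
      rintro (W | V) u
      · exact c.errorProb_nonneg _ _
      · exact div_nonneg (c.divergence_nonneg _ _) hK0.le)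
    (by
      rintro (W | V) u
      · exact c.errorProb_le_one _ _
      · exact (div_le_one hK0).2 ((c.divergence_le _ _).trans hK))
    hlam0
    (by rintro (W | V) <;> assumption)
    (by rintro (W | V) <;> assumption)
    (by
      rintro (W | V)
      · have := hl W.1 W.2
        rw [← Finset.mul_sum, one_div, inv_mul_le_iff₀ hM] at this
        simpa using this
      · have := hμ V.1 V.2
        rw [leakage_uniform, ← Finset.mul_sum, one_div, inv_mul_le_iff₀ hM] at this
        simp only [Sum.elim_inr, Fintype.card_fin]
        rw [← Finset.sum_div, ← mul_div_assoc]
        exact div_le_div_of_nonneg_right this hK0.le)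
    (by
      rw [← Nat.card_eq_fintype_card, Nat.card_sum, Nat.card_coe_set_eq, Nat.card_coe_set_eq]
      simpa using hsmall)
  -- An empty bin would have sum `0`, which the strict inequality excludes; this needs at least one
  -- channel in the family.
  have hsurj : Function.Surjective f := by
    intro j
    by_contra! hj
    obtain ⟨W, hW⟩ := G.main_nonempty n
    have := hf (Sum.inl ⟨W, hW⟩) j
    rw [Finset.filter_false_of_mem fun u _ => hj u] at this
    simp at this
  refine ⟨c.binned hm f hsurj, rfl, fun W hW j => ?_, fun V hV P hP => ?_⟩
  · exact (c.errorProb_binned_le hm f hsurj W j).trans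
      (sum_fiberWeight_mul_le hsurj (hf (Sum.inl ⟨W, hW⟩) j).le)
  · refine c.leakage_binned_le hm f hsurj V (fun j => ?_) hP
    have h := sum_fiberWeight_mul_le hsurj (hf (Sum.inr ⟨V, hV⟩) j).le
    simp only [Sum.elim_inr, ← mul_div_assoc] at h
    rwa [← Finset.sum_div, div_le_div_iff_of_pos_right hK0] at h

/-- The number of messages of a code with small average error. -/
theorem M_mul_le (c : G.Code n) {l : ℝ} (hl : c.AverageError l) :
    c.M * (1 - l) ≤ Fintype.card (∀ i, G.Y n i) := by
  obtain ⟨W, hW⟩ := G.main_nonempty n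
  have h := hl W hW
  rw [← Finset.mul_sum, one_div, inv_mul_le_iff₀ c.M_pos'] at h
  -- Each output has probability at most one, so the success probability is at most the size of the
  -- decoding set; these sizes add up to the output alphabet.
  have h1 : ∀ u, 1 - c.errorProb W u ≤ ((Finset.univ.filter fun y => c.dec y = u).card : ℝ) := by
    intro u
    have h2 := Finset.sum_filter_add_sum_filter_not Finset.univ (fun y => c.dec y = u)
      (outputProb c.enc W u)
    rw [sum_outputProb] at h2
    have h3 : c.errorProb W u = ∑ y with ¬ c.dec y = u, outputProb c.enc W u y := rfl
    rw [h3, ← h2, add_sub_cancel_right]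
    refine (Finset.sum_le_sum fun y _ => outputProb_le_one c.enc W u y).trans ?_
    simp
  have h4 := Finset.sum_le_sum fun u (_ : u ∈ Finset.univ) => h1 u
  have h5 : ∑ u, (Finset.univ.filter fun y => c.dec y = u).card = Fintype.card (∀ i, G.Y n i) :=
    (Finset.card_eq_sum_card_fiberwise (f := c.dec) (fun _ _ => Finset.mem_coe.2 (Finset.mem_univ _))).symm
  rw [← Nat.cast_sum, h5, Finset.sum_sub_distrib] at h4
  simp only [Finset.sum_const, Finset.card_univ, Fintype.card_fin, nsmul_eq_mul, mul_one] at h4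
  linarith

theorem MaximalError.averageError {c : G.Code n} {l : ℝ} (h : c.MaximalError l) :
    c.AverageError l := by
  intro W hW
  refine (Finset.sum_le_sum fun u _ =>
    mul_le_mul_of_nonneg_left (h W hW u) (one_div_nonneg.2 c.M_pos'.le)).trans ?_
  rw [← Finset.sum_mul, c.sum_uniform, one_mul]

theorem MISecure.stronglySecure {c : G.Code n} {m : ℝ} (h : c.MISecure m) :
    c.StronglySecure m := fun V hV => h V hV _ c.uniform_mem

end GAVWC.Code

/-! ### Asymptotics: the rate loss of binning and finiteness of the capacities -/

/-- Here `T = 2^(ns)`, so `2^T` bounds the size of each family, and `Q` is the exponential slack in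
the bin size. By `hQ` the exponent of the binning failure exceeds `T (3 + nD)`, which beats the `2 +
T + nD` coming from the union bound. -/
theorem union_bound_lt_one {T D κ Q n w M m : ℝ} (hT : 1 ≤ T) (hn : 1 ≤ n) (hD : 0 ≤ D)
    (hκ : 0 < κ) (hm : 0 < m) (hw : w ≤ 2 * (2 : ℝ) ^ T) (hmD : m ≤ 2 * (2 : ℝ) ^ (n * D))
    (hM : T * Q / 2 ≤ M / m) (hQ : 24 * n * (3 + n * D) < κ * Q) :
    w * m * Real.exp (-(M / m * (κ / n / 12))) < 1 := by
  have hpow : ∀ x : ℝ, 0 ≤ x → (2 : ℝ) ^ x ≤ Real.exp x := by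
    intro x hx
    rw [← Real.exp_one_rpow]
    exact Real.rpow_le_rpow (by norm_num) (by linarith [Real.exp_one_gt_d9]) hx
  have h4 : (4 : ℝ) ≤ Real.exp 2 := by
    have := hpow 2 (by norm_num)
    norm_num at this
    exact this
  have hnD : 0 ≤ n * D := by positivity
  have hn0 : 0 < n := by linarith
  calc w * m * Real.exp (-(M / m * (κ / n / 12)))
      ≤ (2 * (2 : ℝ) ^ T) * (2 * (2 : ℝ) ^ (n * D)) *
          Real.exp (-(T * Q / 2 * (κ / n / 12))) := by gcongr
    _ = 4 * (2 : ℝ) ^ T * (2 : ℝ) ^ (n * D) * Real.exp (-(T * Q / 2 * (κ / n / 12))) := by ring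
    _ ≤ Real.exp 2 * Real.exp T * Real.exp (n * D) *
          Real.exp (-(T * Q / 2 * (κ / n / 12))) := by
        gcongr
        · exact hpow T (by linarith)
        · exact hpow _ hnD
    _ = Real.exp (2 + T + n * D + -(T * Q / 2 * (κ / n / 12))) := by simp only [Real.exp_add]
    _ < 1 := by
        rw [Real.exp_lt_one_iff]
        have h1 : 3 + n * D < Q * κ / (24 * n) := by
          rw [lt_div_iff₀ (by positivity)]; linarith
        have h2 : T * Q / 2 * (κ / n / 12) = T * (Q * κ / (24 * n)) := by field_simp; ring
        rw [h2]
        nlinarith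

theorem eventually_mul_lt_mul_pow {κ q D : ℝ} (hκ : 0 < κ) (hq : 1 < q) :
    ∀ᶠ n : ℕ in atTop, 24 * (n : ℝ) * (3 + n * D) < κ * q ^ n := by
  have h1 := tendsto_pow_const_div_const_pow_of_one_lt 1 hq
  have h2 := tendsto_pow_const_div_const_pow_of_one_lt 2 hq
  have h3 := (h1.const_mul 72).add (h2.const_mul (24 * D))
  simp only [mul_zero, add_zero] at h3
  filter_upwards [h3.eventually (gt_mem_nhds hκ)] with n hn
  have hqn : 0 < q ^ n := by positivity
  rw [← mul_div_assoc, ← mul_div_assoc, ← add_div, div_lt_iff₀ hqn] at hn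
  linarith

theorem mutualInfo_of_subsingleton {U B : Type} [Fintype U] [Fintype B] [Subsingleton U]
    {P : U → ℝ} (hP : ∑ u, P u = 1) (Q : U → B → ℝ) : mutualInfo P Q = 0 := by
  refine Finset.sum_eq_zero fun u _ => mul_eq_zero_of_right _ (Finset.sum_eq_zero fun b _ => ?_)
  rw [Fintype.sum_subsingleton _ u] at hP ⊢
  rw [hP, one_mul]
  by_cases h : Q u b = 0
  · simp [h]
  · simp [div_self h]

namespace GAVWC

variable {G : GAVWC}

theorem AchievableMI.achievableStrong {R : ℝ} (h : G.AchievableMI R) : G.AchievableStrong R :=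
  ⟨h.1, fun ε l m hε hl hm => (h.2 ε l m hε hl hm).mono
    fun _ ⟨c, h1, h2, h3⟩ => ⟨c, h1, h2.averageError, h3.stronglySecure⟩⟩

/-- The code with a single message. -/
def trivialCode (G : GAVWC) (n : ℕ) : G.Code n where
  M := 1
  M_pos := one_pos
  enc _ := stdSimplex.barycenter
  dec _ := 0

theorem achievableMI_zero (G : GAVWC) : G.AchievableMI 0 := by
  refine ⟨le_rfl, fun ε l m hε hl hm => Eventually.of_forall fun n => ⟨G.trivialCode n, ?_, ?_, ?_⟩⟩
  · simp [Code.rate, trivialCode, hε]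
  · intro W _ u
    rw [Code.errorProb_eq_sum_ite, Finset.sum_eq_zero]
    · exact hl.le
    · intro y _
      rw [if_pos]
      exact Subsingleton.elim (α := Fin 1) _ _
  · intro V _ P hP
    have : Subsingleton (Fin (G.trivialCode n).M) := inferInstanceAs (Subsingleton (Fin 1))
    exact (mutualInfo_of_subsingleton hP.2 _).trans_le hm.le

theorem one_le_of_card_le {c : ℕ} (hc : ∀ n, Fintype.card (∀ i, G.Y n i) ≤ c ^ n) : 1 ≤ c := by
  have h := (Fintype.card_pos (α := ∀ i, G.Y 1 i)).trans_le (hc 1)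
  rw [pow_one] at h
  exact h

theorem Code.logb_M_le {n c : ℕ} (hc : ∀ n, Fintype.card (∀ i, G.Y n i) ≤ c ^ n) (C : G.Code n)
    {l : ℝ} (hl : l ≤ 1 / 2) (h : C.AverageError l) :
    Real.logb 2 C.M ≤ 1 + n * Real.logb 2 c := by
  have hc1 : 0 < (c : ℝ) := by exact_mod_cast one_le_of_card_le hc
  have h1 : (C.M : ℝ) ≤ 2 * (c : ℝ) ^ n := by
    have h2 := C.M_mul_le h
    have h3 : (Fintype.card (∀ i, G.Y n i) : ℝ) ≤ (c : ℝ) ^ n := by exact_mod_cast hc n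
    have := C.M_pos'
    nlinarith
  calc Real.logb 2 C.M ≤ Real.logb 2 (2 * (c : ℝ) ^ n) :=
        Real.logb_le_logb_of_le (by norm_num) C.M_pos' h1
    _ = 1 + n * Real.logb 2 c := by
        rw [Real.logb_mul (by norm_num) (by positivity), Real.logb_self_eq_one (by norm_num),
          Real.logb_pow]

/-- Achievable rates are at most the exponential growth rate of the output alphabets. -/
theorem AchievableStrong.le_logb {R : ℝ} {c : ℕ}
    (hc : ∀ n, Fintype.card (∀ i, G.Y n i) ≤ c ^ n) (h : G.AchievableStrong R) :
    R ≤ Real.logb 2 c := by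
  refine le_of_forall_pos_le_add fun ε hε => ?_
  obtain ⟨n, ⟨C, hR, he, -⟩, hn, hn0⟩ := ((h.2 (ε / 2) (1 / 2) 1 (by positivity) (by norm_num)
    one_pos).and (((tendsto_one_div_atTop_nhds_zero_nat (𝕜 := ℝ)).eventually
      (gt_mem_nhds (show (0 : ℝ) < ε / 2 by positivity))).and (eventually_gt_atTop 0))).exists
  have hn0 : (0 : ℝ) < n := by exact_mod_cast hn0
  have h1 : C.rate ≤ 1 / n + Real.logb 2 c := by
    rw [Code.rate, div_le_iff₀ hn0]
    refine (C.logb_M_le hc le_rfl he).trans (le_of_eq ?_)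
    field_simp
  linarith

theorem capacityMI_nonneg (G : GAVWC) : 0 ≤ G.capacityMI :=
  le_iSup₂_of_le (f := fun (R : ℝ) (_ : G.AchievableMI R) => (R : EReal)) 0 G.achievableMI_zero
    le_rfl

theorem capacityMI_le_capacityStrong (G : GAVWC) : G.capacityMI ≤ G.capacityStrong :=
  iSup₂_le fun R hR => le_iSup₂_of_le
    (f := fun (R : ℝ) (_ : G.AchievableStrong R) => (R : EReal)) R hR.achievableStrong le_rfl

theorem capacityStrong_le {c : ℕ} (hc : ∀ n, Fintype.card (∀ i, G.Y n i) ≤ c ^ n) :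
    G.capacityStrong ≤ (Real.logb 2 c : ℝ) :=
  iSup₂_le fun _ hR => EReal.coe_le_coe_iff.2 (hR.le_logb hc)

theorem capacityStrong_ne_top (G : GAVWC) : G.capacityStrong ≠ ⊤ := by
  obtain ⟨c, hc⟩ := G.card_le
  exact ((capacityStrong_le fun n => (hc n).2.1).trans_lt (EReal.coe_lt_top _)).ne

theorem capacityMI_ne_top (G : GAVWC) : G.capacityMI ≠ ⊤ :=
  ((capacityMI_le_capacityStrong G).trans_lt (lt_top_iff_ne_top.2 G.capacityStrong_ne_top)).ne

/-- If the families of channels are finite of size at most `2 ^ 2 ^ (n s)`, then passing from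
average error and strong security to maximal error and semantic security costs a rate of at most
`s`. -/
theorem AchievableStrong.achievableMI_sub {R s : ℝ} (h : G.AchievableStrong R) (hs : 0 ≤ s)
    (hRs : s ≤ R)
    (hW : ∀ᶠ n : ℕ in atTop, (G.main n).Finite ∧
      ((G.main n).ncard : ℝ) ≤ (2 : ℝ) ^ (2 : ℝ) ^ (n * s))
    (hV : ∀ᶠ n : ℕ in atTop, (G.wiretap n).Finite ∧
      ((G.wiretap n).ncard : ℝ) ≤ (2 : ℝ) ^ (2 : ℝ) ^ (n * s)) :
    G.AchievableMI (R - s) := by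
  refine ⟨sub_nonneg.2 hRs, fun ε l m hε hl hm => ?_⟩
  -- A negative target rate is met by the single-message code.
  rcases lt_or_ge (R - s - ε) 0 with hD | hD
  · filter_upwards [G.achievableMI_zero.2 (-(R - s - ε)) l m (by linarith) hl hm]
    rintro n ⟨c, h1, h2⟩
    exact ⟨c, by linarith, h2⟩
  obtain ⟨c, hc⟩ := G.card_le
  have hcY : ∀ n, Fintype.card (∀ i, G.Y n i) ≤ c ^ n := fun n => (hc n).2.1
  set L := Real.logb 2 (c : ℝ) with hL
  have hL0 : 0 ≤ L := Real.logb_nonneg (by norm_num) (by exact_mod_cast one_le_of_card_le hcY)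
  -- Halved because binning doubles the bounds on error and leakage; the caps keep the normalised
  -- means at most one, and `1 / 2` also bounds the number of messages.
  set l' := min (l / 2) (1 / 2) with hl'
  have hl'0 : 0 < l' := lt_min (by positivity) (by norm_num)
  set μ := min (m / 2) 1 with hμ
  have hμ0 : 0 < μ := lt_min (by positivity) (by norm_num)
  -- With `K = n (L + 2)`, `κ / n` lies below both `l'` and `μ / K`.
  set κ := min l' μ / (L + 2) with hκ
  have hκ0 : 0 < κ := div_pos (lt_min hl'0 hμ0) (by linarith)
  set q := (2 : ℝ) ^ (ε / 2) with hq
  have hq1 : 1 < q := Real.one_lt_rpow (by norm_num) (by positivity)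
  filter_upwards [h.2 (ε / 2) l' μ (by positivity) hl'0 hμ0, hW, hV,
    eventually_mul_lt_mul_pow (D := R - s - ε) hκ0 hq1, eventually_ge_atTop 1]
  rintro n ⟨C, hrate, herr, hsec⟩ ⟨hWf, hWc⟩ ⟨hVf, hVc⟩ hlarge hn
  have hn1 : (1 : ℝ) ≤ n := by exact_mod_cast hn
  have hn0 : (0 : ℝ) < n := by linarith
  have hK1 : 1 ≤ n * (L + 2) := by nlinarith
  have hK0 : 0 < n * (L + 2) := by linarith
  have hK : Real.logb 2 C.M ≤ n * (L + 2) := by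
    refine (C.logb_M_le hcY (min_le_right _ _) herr).trans ?_
    rw [← hL]; linarith
  have hM : (2 : ℝ) ^ (n * (R - ε / 2)) ≤ C.M := by
    rw [← Real.le_logb_iff_rpow_le (by norm_num) C.M_pos']
    rw [Code.rate, lt_div_iff₀ hn0] at hrate
    linarith
  set D := R - s - ε with hDdef
  have hfl : (⌊(2 : ℝ) ^ (n * D)⌋₊ : ℝ) ≤ (2 : ℝ) ^ (n * D) := Nat.floor_le (by positivity)
  have h1le : 1 ≤ (2 : ℝ) ^ (n * D) := Real.one_le_rpow (by norm_num) (by positivity)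
  have hT : 1 ≤ (2 : ℝ) ^ (n * s) := Real.one_le_rpow (by norm_num) (by positivity)
  have hmle : ((⌊(2 : ℝ) ^ (n * D)⌋₊ + 1 : ℕ) : ℝ) ≤ 2 * (2 : ℝ) ^ (n * D) := by
    push_cast; linarith
  -- The extra message beyond the floor makes the rate strictly larger than `D = R - s - ε`. In the
  -- bin size, `D + s + ε/2 = R - ε/2`: half of `ε` is lost in the original code, half is the slack
  -- `q ^ n`.
  obtain ⟨C', hC'M, hC'⟩ := C.exists_maximalError_miSecure (Nat.succ_pos ⌊(2 : ℝ) ^ (n * D)⌋₊)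
    (l := l') (μ := μ) (K := n * (L + 2)) (lam0 := κ / n) hWf hVf herr hsec hK hK0
    (div_pos hκ0 hn0)
    (by
      rw [hκ, div_div, div_le_iff₀ (by positivity)]
      have := min_le_left l' μ
      nlinarith)
    ((min_le_right _ _).trans (by norm_num))
    (by
      rw [hκ, div_div, mul_comm (L + 2)]
      exact div_le_div_of_nonneg_right (min_le_right _ _) hK0.le)
    ((div_le_one hK0).2 ((min_le_right _ _).trans hK1))
    (by
      refine union_bound_lt_one (T := (2 : ℝ) ^ (n * s)) (D := D) (Q := q ^ n) hT hn1 hD hκ0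
        (by positivity) (by linarith) hmle ?_ hlarge
      rw [le_div_iff₀ (by positivity)]
      calc (2 : ℝ) ^ (n * s) * q ^ n / 2 * ((⌊(2 : ℝ) ^ (n * D)⌋₊ + 1 : ℕ) : ℝ)
          ≤ (2 : ℝ) ^ (n * s) * q ^ n / 2 * (2 * (2 : ℝ) ^ (n * D)) := by gcongr
        _ = (2 : ℝ) ^ (n * (R - ε / 2)) := by
          rw [hq, ← Real.rpow_natCast, ← Real.rpow_mul (by norm_num)]
          rw [show (2 : ℝ) ^ (n * s) * (2 : ℝ) ^ (ε / 2 * n) / 2 * (2 * (2 : ℝ) ^ (n * D)) =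
            (2 : ℝ) ^ (n * s) * (2 : ℝ) ^ (ε / 2 * n) * (2 : ℝ) ^ (n * D) by ring,
            ← Real.rpow_add (by norm_num), ← Real.rpow_add (by norm_num)]
          congr 1
          rw [hDdef]; ring
        _ ≤ C.M := hM)
  refine ⟨C', ?_, fun W hW u => (hC'.1 W hW u).trans ?_, fun V hV P hP =>
    (hC'.2 V hV P hP).trans ?_⟩
  · rw [Code.rate, lt_div_iff₀ hn0, hC'M, mul_comm,
      Real.lt_logb_iff_rpow_lt (by norm_num) (by positivity)]
    push_cast
    exact Nat.lt_floor_add_one _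
  · have := min_le_left (l / 2) (1 / 2)
    linarith
  · have := min_le_left (m / 2) 1
    linarith

end GAVWC

/-! ### Double exponential rates and the bound on the difference of the capacities -/

/-- The convention at `1` agrees with the default value `Real.logb 2 0 = 0`. -/
theorem logLog_of_ne_top {t : ℝ≥0∞} (ht : t ≠ ⊤) :
    logLog t = (Real.logb 2 (Real.logb 2 t.toReal) : ℝ) := by
  unfold logLog
  rw [if_neg ht]
  split_ifs with h
  · simp [h]
  · rfl

theorem logLog_natCast (N : ℕ) : logLog (N : ℝ≥0∞) = (Real.logb 2 (Real.logb 2 N) : ℝ) := by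
  rw [logLog_of_ne_top (ENNReal.natCast_ne_top N), ENNReal.toReal_natCast]

theorem logLog_top : logLog ⊤ = ⊤ := if_pos rfl

theorem logb_logb_natCast_nonneg (N : ℕ) : 0 ≤ Real.logb 2 (Real.logb 2 N) := by
  rcases lt_or_ge N 2 with h | h
  · interval_cases N <;> simp
  · refine Real.logb_nonneg (by norm_num) ?_
    rw [Real.le_logb_iff_rpow_le (by norm_num) (by positivity), Real.rpow_one]
    exact_mod_cast h

theorem coe_div_natCast (x : ℝ) (n : ℕ) : (x : EReal) / (n : EReal) = ((x / n : ℝ) : EReal) := by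
  rw [EReal.coe_div, EReal.coe_natCast]

theorem doubleExpRate_encard_nonneg {α : ℕ → Type} (S : ∀ n, Set (α n)) :
    0 ≤ doubleExpRate fun n => ((S n).encard : ℝ≥0∞) := by
  refine le_limsup_of_frequently_le (Frequently.of_forall fun n => ?_)
  beta_reduce
  by_cases h : (S n).Finite
  · rw [← h.cast_ncard_eq, ENat.toENNReal_coe, logLog_natCast, coe_div_natCast]
    exact_mod_cast div_nonneg (logb_logb_natCast_nonneg _) (Nat.cast_nonneg n)
  · rw [Set.encard_eq_top_iff.2 h, ENat.toENNReal_top, logLog_top]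
    exact EReal.div_nonneg le_top (by positivity)

theorem eventually_ncard_le {α : ℕ → Type} (S : ∀ n, Set (α n)) {s : ℝ}
    (h : doubleExpRate (fun n => ((S n).encard : ℝ≥0∞)) < s) :
    ∀ᶠ n : ℕ in atTop, (S n).Finite ∧ ((S n).ncard : ℝ) ≤ (2 : ℝ) ^ (2 : ℝ) ^ (n * s) := by
  filter_upwards [eventually_lt_of_limsup_lt h, eventually_gt_atTop 0] with n hn hn0
  have hn0 : (0 : ℝ) < n := by exact_mod_cast hn0
  by_cases hf : (S n).Finite
  · refine ⟨hf, ?_⟩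
    rw [← hf.cast_ncard_eq, ENat.toENNReal_coe, logLog_natCast, coe_div_natCast,
      EReal.coe_lt_coe_iff, div_lt_iff₀ hn0] at hn
    rcases lt_or_ge (S n).ncard 2 with h2 | h2
    · have : ((S n).ncard : ℝ) ≤ 1 := by exact_mod_cast Nat.lt_succ_iff.1 h2
      exact this.trans (Real.one_le_rpow (by norm_num) (by positivity))
    · have hN : (0 : ℝ) < (S n).ncard := by positivity
      have h1 : 0 < Real.logb 2 (S n).ncard :=
        Real.logb_pos (by norm_num) (by exact_mod_cast h2)
      rw [Real.logb_lt_iff_lt_rpow (by norm_num) h1,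
        Real.logb_lt_iff_lt_rpow (by norm_num) hN] at hn
      rw [mul_comm]
      exact hn.le
  · rw [Set.encard_eq_top_iff.2 hf, ENat.toENNReal_top, logLog_top,
      EReal.top_div_of_pos_ne_top (by exact_mod_cast hn0) (EReal.natCast_ne_top n)] at hn
    exact absurd hn not_top_lt

namespace GAVWC

/-- The bound on the difference of the capacities, which needs no assumption on `G.minProb`: the
relative entropies to the mean output distribution are at most `log₂ M`. -/
theorem capacityStrong_sub_capacityMI_le (G : GAVWC) :
    G.capacityStrong - G.capacityMI ≤ max G.mainRate G.wiretapRate := by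
  refine EReal.le_of_forall_lt_iff_le.1 fun s hs => ?_
  have hs0 : 0 ≤ s := EReal.coe_nonneg.1
    (((doubleExpRate_encard_nonneg G.main).trans (le_max_left _ _)).trans hs.le)
  refine EReal.sub_le_of_le_add (iSup₂_le fun R hR => ?_)
  -- The rate `R - s` is a candidate only if it is nonnegative; otherwise nonnegativity of the
  -- semantic capacity suffices.
  rcases le_total R s with h | h
  · calc (R : EReal) ≤ s := EReal.coe_le_coe_iff.2 h
      _ = s + 0 := (add_zero _).symm
      _ ≤ s + G.capacityMI := by gcongr; exact G.capacityMI_nonneg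
  · calc (R : EReal) = s + ((R - s : ℝ) : EReal) := by rw [← EReal.coe_add]; congr 1; ring
      _ ≤ s + G.capacityMI := by
        gcongr
        exact le_iSup₂_of_le (f := fun (R : ℝ) (_ : G.AchievableMI R) => (R : EReal)) (R - s)
          (hR.achievableMI_sub hs0 h
            (eventually_ncard_le G.main ((le_max_left _ _).trans_lt hs))
            (eventually_ncard_le G.wiretap ((le_max_right _ _).trans_lt hs))) le_rfl

end GAVWC

/-! ### Information estimates for the example -/

/-- A lower bound on the relative entropy of two probability vectors in terms of the
probabilities of an event. -/
theorem sum_sub_sum_div_le_relEntropy {B : Type} [Fintype B] {p q : B → ℝ}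
    (hp : ∀ b, 0 ≤ p b) (hq : ∀ b, 0 ≤ q b) (hpq : ∀ b, q b = 0 → p b = 0)
    (hp1 : ∑ b, p b = 1) (hq1 : ∑ b, q b = 1) (A : Finset B) :
    ∑ b ∈ A, p b - (∑ b ∈ A, q b) / Real.log 2 ≤ relEntropy p q := by
  classical
  have h2 : 0 < Real.log 2 := Real.log_pos (by norm_num)
  -- Tangent slope `2` on `A` and `1` off it; the terms `p - q` cancel in the sum.
  have h : ∀ b, ((p b - q b) + if b ∈ A then (p b * Real.log 2 - q b) else 0) / Real.log 2 ≤
      p b * Real.logb 2 (p b / q b) := by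
    intro b
    split_ifs
    · refine le_trans (le_of_eq ?_)
        (tangent_le_mul_logb_div (hp b) (hq b) (t := 2) (by norm_num) (hpq b))
      ring
    · refine le_trans (le_of_eq ?_)
        (tangent_le_mul_logb_div (hp b) (hq b) one_pos (hpq b))
      simp
  refine le_trans (le_of_eq ?_) (Finset.sum_le_sum fun b _ => h b)
  rw [← Finset.sum_div, Finset.sum_add_distrib, Finset.sum_sub_distrib, hp1, hq1,
    Finset.sum_ite_mem, Finset.univ_inter, Finset.sum_sub_distrib, ← Finset.sum_mul]
  field_simp
  ring

/-- The uniform distribution on the pair `u`, `v`. -/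
def pairDist {U : Type} [DecidableEq U] (u v w : U) : ℝ :=
  (if w = u then 1 / 2 else 0) + if w = v then 1 / 2 else 0

theorem sum_pairDist_mul {U : Type} [Fintype U] [DecidableEq U] (u v : U) (g : U → ℝ) :
    ∑ w, pairDist u v w * g w = (g u + g v) / 2 := by
  simp only [pairDist, add_mul, ite_mul, zero_mul, Finset.sum_add_distrib, Finset.sum_ite_eq',
    Finset.mem_univ, if_true]
  ring

theorem pairDist_mem {U : Type} [Fintype U] [DecidableEq U] (u v : U) :
    pairDist u v ∈ stdSimplex ℝ U := by
  refine ⟨fun w => ?_, ?_⟩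
  · unfold pairDist
    split_ifs <;> norm_num
  · have := sum_pairDist_mul u v fun _ => 1
    simp only [mul_one] at this
    rw [this]; norm_num

/-- Two reliably distinguishable inputs carry a positive amount of information. -/
theorem lt_mutualInfo_pairDist {U B : Type} [Fintype U] [DecidableEq U] [Fintype B]
    {Q : U → B → ℝ} (hQ : ∀ u b, 0 ≤ Q u b) (hQ1 : ∀ u, ∑ b, Q u b = 1) (u v : U)
    (A : Finset B) (hu : 19 / 20 ≤ ∑ b ∈ A, Q u b) (hv : ∑ b ∈ A, Q v b ≤ 1 / 20) :
    1 / 20 < mutualInfo (pairDist u v) Q := by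
  rw [mutualInfo_eq_sum_relEntropy, sum_pairDist_mul]
  simp only [sum_pairDist_mul]
  have h0 : ∀ b, 0 ≤ (Q u b + Q v b) / 2 := fun b => by linarith [hQ u b, hQ v b]
  have h1 : ∑ b, (Q u b + Q v b) / 2 = 1 := by
    rw [← Finset.sum_div, Finset.sum_add_distrib, hQ1, hQ1]; norm_num
  have hDv : 0 ≤ relEntropy (Q v) fun b => (Q u b + Q v b) / 2 :=
    relEntropy_nonneg (hQ v) h0 (fun b hb => by linarith [hQ u b, hQ v b]) (by rw [h1, hQ1])
  have hDu := sum_sub_sum_div_le_relEntropy (hQ u) h0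
    (fun b hb => by linarith [hQ u b, hQ v b]) (hQ1 u) h1 A
  have hA1 : ∑ b ∈ A, Q u b ≤ 1 := by
    rw [← hQ1 u]
    exact Finset.sum_le_sum_of_subset_of_nonneg (Finset.subset_univ _) fun b _ _ => hQ u b
  -- The mixture gives `A` mass at most `21/40`, and `21/40 ≤ (4/5) ln 2`. Then the divergence of
  -- `u` is at least `19/20 - 4/5 = 3/20`, and half of it exceeds `1/20`.
  have hlog : (∑ b ∈ A, (Q u b + Q v b) / 2) / Real.log 2 ≤ 4 / 5 := by
    rw [← Finset.sum_div, Finset.sum_add_distrib,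
      div_le_iff₀ (Real.log_pos (by norm_num))]
    linarith [Real.log_two_gt_d9]
  linarith

section subsetChannel

variable {A : Type} [Fintype A] [Nonempty A] [DecidableEq A]

theorem subsetChannel_of_mem {Θ : Finset A} {x : A} (hx : x ∈ Θ) (z : A) :
    subsetChannel Θ x z = if z = x then 1 else 0 := by
  simp [subsetChannel, hx, stdSimplex.vertex, Pi.single_apply]

theorem subsetChannel_of_notMem {Θ : Finset A} {x : A} (hx : x ∉ Θ) (z : A) :
    subsetChannel Θ x z = 1 / Fintype.card A := by
  simp only [subsetChannel, hx, if_false, one_div]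
  rfl

/-- `Θ` is recovered as the set of inputs reproduced with probability one; on a one-point alphabet
the uniform output would be noiseless too. -/
theorem subsetChannel_injective (hA : 2 ≤ Fintype.card A) :
    Function.Injective (subsetChannel : Finset A → Channel A A) := by
  have key : ∀ (Θ : Finset A) x, x ∈ Θ ↔ subsetChannel Θ x x = 1 := by
    intro Θ x
    by_cases hx : x ∈ Θ
    · simp [hx, subsetChannel_of_mem hx]
    · rw [subsetChannel_of_notMem hx]
      have h2 : (2 : ℝ) ≤ Fintype.card A := by exact_mod_cast hA
      have : (1 : ℝ) / Fintype.card A < 1 := by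
        rw [div_lt_one (by linarith)]; linarith
      simp only [hx, false_iff]
      exact this.ne
  intro Θ Θ' h
  ext x
  rw [key, key, h]

/-- The information leaked by a subset channel when the input is uniformly distributed. -/
theorem mutualInfo_subsetChannel_le (Θ : Finset A) {t : ℝ} (ht1 : t < 1)
    (ht : (Θ.card : ℝ) ≤ t * Fintype.card A) :
    mutualInfo (fun _ : A => 1 / (Fintype.card A : ℝ)) (fun x z => subsetChannel Θ x z) ≤
      t * Real.logb 2 (Fintype.card A) + Real.logb 2 (1 / (1 - t)) := by
  set N : ℝ := (Fintype.card A : ℝ) with hN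
  have hN0 : 0 < N := by rw [hN]; exact_mod_cast Fintype.card_pos
  have hN1 : 1 ≤ N := by rw [hN]; exact_mod_cast Fintype.card_pos
  have ht0 : 0 ≤ t := by
    by_contra! h
    have : (0 : ℝ) ≤ Θ.card := by positivity
    nlinarith
  have hlog : 0 ≤ Real.logb 2 (1 / (1 - t)) :=
    Real.logb_nonneg (by norm_num) (by rw [le_div_iff₀ (by linarith)]; linarith)
  have h0 : ∀ x z, 0 ≤ subsetChannel Θ x z := fun x z => stdSimplex.zero_le (subsetChannel Θ x) z
  have hm0 : ∀ z, 0 ≤ ∑ x, 1 / N * subsetChannel Θ x z := fun z =>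
    Finset.sum_nonneg fun x _ => mul_nonneg (by positivity) (h0 x z)
  -- The inputs outside `Θ` alone spread this much mass over every output.
  have hm : ∀ z, (1 - t) / N ≤ ∑ x, 1 / N * subsetChannel Θ x z := by
    intro z
    calc (1 - t) / N ≤ ∑ x ∈ Θᶜ, 1 / N * (1 / N) := by
          rw [Finset.sum_const, nsmul_eq_mul, Finset.card_compl,
            Nat.cast_sub (Finset.card_le_univ Θ), ← hN, ← mul_assoc, mul_one_div,
            mul_one_div, div_div, div_le_div_iff₀ hN0 (by positivity)]
          nlinarith
      _ = ∑ x ∈ Θᶜ, 1 / N * subsetChannel Θ x z :=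
          Finset.sum_congr rfl fun x hx => by
            rw [subsetChannel_of_notMem (Finset.mem_compl.1 hx)]
      _ ≤ _ := Finset.sum_le_sum_of_subset_of_nonneg (Finset.subset_univ _)
          fun x _ _ => mul_nonneg (by positivity) (h0 x z)
  -- An input in `Θ` can cost the full `log₂ N`, but such inputs have total weight at most `t`; any
  -- other input has output at most `1 / (1 - t)` times the mean.
  have hD : ∀ x, relEntropy (subsetChannel Θ x) (fun z => ∑ x, 1 / N * subsetChannel Θ x z) ≤
      (if x ∈ Θ then Real.logb 2 N else 0) + Real.logb 2 (1 / (1 - t)) := by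
    intro x
    split_ifs with hx
    · have := relEntropy_le_logb (K := N) (h0 x) (stdSimplex.sum_eq_one (subsetChannel Θ x)) hm0
        fun z => by
          rw [← Finset.mul_sum, ← mul_assoc, mul_one_div_cancel hN0.ne', one_mul]
          exact Finset.single_le_sum (f := fun x => subsetChannel Θ x z) (fun x _ => h0 x z)
            (Finset.mem_univ x)
      linarith
    · rw [zero_add]
      refine relEntropy_le_logb (h0 x) (stdSimplex.sum_eq_one (subsetChannel Θ x)) hm0 fun z => ?_
      rw [subsetChannel_of_notMem hx, ← hN, one_div_mul_eq_div, le_div_iff₀ (by linarith)]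
      refine le_trans (le_of_eq ?_) (hm z)
      ring
  rw [mutualInfo_eq_sum_relEntropy]
  refine (Finset.sum_le_sum fun x _ => mul_le_mul_of_nonneg_left (hD x) (by positivity)).trans ?_
  rw [← Finset.mul_sum, Finset.sum_add_distrib, Finset.sum_ite_mem, Finset.univ_inter]
  simp only [Finset.sum_const, Finset.card_univ, nsmul_eq_mul]
  rw [← hN, one_div, inv_mul_le_iff₀ hN0]
  have := mul_le_mul_of_nonneg_right ht (Real.logb_nonneg (b := 2) (by norm_num) hN1)
  nlinarith

end subsetChannel

theorem mutualInfo_comp_equiv {U U' B : Type} [Fintype U] [Fintype U'] [Fintype B] (e : U ≃ U')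
    (P : U' → ℝ) (Q : U' → B → ℝ) :
    mutualInfo (fun u => P (e u)) (fun u => Q (e u)) = mutualInfo P Q := by
  unfold mutualInfo
  rw [← e.sum_comp]
  refine Finset.sum_congr rfl fun u _ => ?_
  congr 1
  refine Finset.sum_congr rfl fun b _ => ?_
  rw [← e.sum_comp (fun v => P v * Q v b)]

theorem outputProb_of_eq_vertex {U A B : Type} [Fintype A] [DecidableEq A] [Fintype B]
    {Φ : Channel U A} (Q : Channel A B) {u : U} {x : A} (h : Φ u = stdSimplex.vertex x) (b : B) :
    outputProb Φ Q u b = Q x b := by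
  simp [outputProb, h, stdSimplex.vertex, Pi.single_apply]

theorem outputProb_noiseless {U A : Type} [Fintype A] [DecidableEq A] (Φ : Channel U A) (u : U)
    (x : A) : outputProb Φ (fun x => stdSimplex.vertex x) u x = Φ u x := by
  simp [outputProb, stdSimplex.vertex, Pi.single_apply]

/-! ### The rates of the channel families in the example -/

/-- Ensures that some input lies outside `Θ`; at `n = 0` both sides are `1`. -/
theorem floor_two_rpow_lt {a : ℝ} (ha : a < 1) {n : ℕ} (hn : 0 < n) :
    ⌊(2 : ℝ) ^ (n * a)⌋₊ < 2 ^ n := by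
  have hn : (0 : ℝ) < n := by exact_mod_cast hn
  rw [Nat.floor_lt (by positivity)]
  push_cast
  rw [← Real.rpow_natCast]
  exact Real.rpow_lt_rpow_of_exponent_lt (by norm_num) (by nlinarith)

theorem half_rpow_le_floor {a : ℝ} (ha : 0 < a) (n : ℕ) :
    (2 : ℝ) ^ (n * a) / 2 ≤ (⌊(2 : ℝ) ^ (n * a)⌋₊ : ℝ) := by
  have h1 : 1 ≤ (2 : ℝ) ^ (n * a) := Real.one_le_rpow (by norm_num) (by positivity)
  have h2 := Nat.lt_floor_add_one ((2 : ℝ) ^ (n * a))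
  have h3 : (1 : ℝ) ≤ (⌊(2 : ℝ) ^ (n * a)⌋₊ : ℝ) := by
    exact_mod_cast Nat.floor_pos.2 h1
  linarith

/-- Compare with the central binomial coefficient, which is at least `4^k / (2k)`, and use `2k ≤
2^k`. -/
theorem two_pow_le_choose {N k : ℕ} (hk : 0 < k) (h : 2 * k ≤ N) : 2 ^ k ≤ N.choose k := by
  have h1 := Nat.four_pow_le_two_mul_self_mul_centralBinom k hk
  have h2 : 2 * k ≤ 2 ^ k := by
    obtain ⟨j, rfl⟩ := Nat.exists_eq_add_of_lt hk
    have := Nat.lt_two_pow_self (n := j)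
    rw [zero_add, pow_succ]
    omega
  have h3 : k.centralBinom ≤ N.choose k := Nat.choose_le_choose k h
  have h4 : 2 ^ k * 2 ^ k ≤ 2 ^ k * N.choose k := by
    calc 2 ^ k * 2 ^ k = 4 ^ k := by rw [← mul_pow]; norm_num
      _ ≤ 2 * k * k.centralBinom := h1
      _ ≤ _ := Nat.mul_le_mul h2 h3
  exact Nat.le_of_mul_le_mul_left h4 (by positivity)

theorem tendsto_logb_two_div : Tendsto (fun n : ℕ => Real.logb 2 n / n) atTop (𝓝 0) := by
  have h := (Real.isLittleO_log_id_atTop.tendsto_div_nhds_zero.comp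
    tendsto_natCast_atTop_atTop).div_const (Real.log 2)
  rw [zero_div] at h
  refine h.congr fun n => ?_
  simp only [Function.comp, id, Real.logb]
  ring

theorem doubleExpRate_eq_of_tendsto {t : ℕ → ℝ≥0∞} {x : ℕ → ℝ} {a : ℝ}
    (ht : ∀ᶠ n in atTop, logLog (t n) = (x n : EReal))
    (hx : Tendsto (fun n : ℕ => x n / n) atTop (𝓝 a)) : doubleExpRate t = a := by
  refine Tendsto.limsup_eq ?_
  refine ((continuous_coe_real_ereal.tendsto a).comp hx).congr' ?_
  filter_upwards [ht] with n hn
  rw [hn, coe_div_natCast]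
  rfl

section Example

variable {a : ℝ} (ha : a < 1)

theorem subsetGAVWC_minProb {n : ℕ} (hn : 0 < n) :
    (subsetGAVWC a ha).minProb n = ENNReal.ofReal (1 / 2 ^ n) := by
  have hcard : (Fintype.card (Fin n → Bool) : ℝ) = 2 ^ n := by simp
  refine le_antisymm ?_ ?_
  · obtain ⟨Θ, -, hΘ⟩ := Finset.exists_subset_card_eq
      (s := (Finset.univ : Finset (Fin n → Bool)))
      (n := ⌊(2 : ℝ) ^ (n * a)⌋₊) (by simpa using floor_two_rpow_le a ha n)
    obtain ⟨x, hx⟩ : ∃ x, x ∉ Θ := by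
      by_contra! h
      rw [Finset.eq_univ_iff_forall.2 h, Finset.card_univ] at hΘ
      have := floor_two_rpow_lt ha hn
      rw [← hΘ] at this
      simp at this
    have hval := subsetChannel_of_notMem hx x
    rw [hcard] at hval
    refine iInf₂_le_of_le (subsetChannel (A := Fin n → Bool) Θ) ⟨Θ, hΘ, rfl⟩
      (iInf₂_le_of_le x x (iInf_le_of_le ?_ ?_))
    · exact lt_of_lt_of_eq (by positivity) hval.symm
    · exact (congrArg ENNReal.ofReal hval).le
  · refine le_iInf₂ fun V hV => le_iInf₂ fun (x z : Fin n → Bool) => le_iInf fun hpos => ?_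
    obtain ⟨Θ, -, rfl⟩ := hV
    refine ENNReal.ofReal_le_ofReal ?_
    change 0 < subsetChannel (A := Fin n → Bool) Θ x z at hpos
    change 1 / 2 ^ n ≤ subsetChannel (A := Fin n → Bool) Θ x z
    by_cases hx : x ∈ Θ
    · rw [subsetChannel_of_mem hx] at hpos ⊢
      split_ifs at hpos ⊢
      · rw [div_le_one (by positivity)]
        exact one_le_pow₀ (by norm_num)
      · exact absurd hpos (lt_irrefl _)
    · rw [subsetChannel_of_notMem hx, hcard]

theorem subsetGAVWC_minProbRate : (subsetGAVWC a ha).minProbRate = 0 := by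
  refine doubleExpRate_eq_of_tendsto (a := 0) ?_ tendsto_logb_two_div
  filter_upwards [eventually_gt_atTop 0] with n hn
  have h : ((subsetGAVWC a ha).minProb n)⁻¹ = ((2 ^ n : ℕ) : ℝ≥0∞) := by
    rw [subsetGAVWC_minProb ha hn, ← ENNReal.ofReal_inv_of_pos (by positivity), one_div, inv_inv,
      ← ENNReal.ofReal_natCast]
    push_cast
    rfl
  rw [h, logLog_natCast]
  push_cast
  rw [Real.logb_pow, Real.logb_self_eq_one (by norm_num), mul_one]

theorem subsetGAVWC_mainRate : (subsetGAVWC a ha).mainRate = 0 := by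
  refine doubleExpRate_eq_of_tendsto (a := 0) (x := fun _ => 0) (Eventually.of_forall fun n => ?_)
    (by simp)
  have h : ((subsetGAVWC a ha).main n).encard = (1 : ℕ) := Set.encard_singleton _
  rw [h, ENat.toENNReal_coe, logLog_natCast]
  simp

theorem subsetGAVWC_encard_wiretap {n : ℕ} (hn : 0 < n) :
    ((subsetGAVWC a ha).wiretap n).encard =
      (((2 ^ n).choose ⌊(2 : ℝ) ^ (n * a)⌋₊ : ℕ) : ℕ∞) := by
  have hA : 2 ≤ Fintype.card (Fin n → Bool) := by
    simpa using Nat.pow_le_pow_right (n := 2) two_pos hn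
  have h : (subsetGAVWC a ha).wiretap n = (subsetChannel : Finset (Fin n → Bool) → _) ''
      ((Finset.powersetCard ⌊(2 : ℝ) ^ (n * a)⌋₊ (Finset.univ : Finset (Fin n → Bool)) :
        Finset (Finset (Fin n → Bool))) : Set (Finset (Fin n → Bool))) := by
    refine Set.ext fun V => ⟨?_, ?_⟩
    · rintro ⟨Θ, hΘ, rfl⟩
      exact ⟨Θ, Finset.mem_coe.2 (Finset.mem_powersetCard_univ.2 hΘ), rfl⟩
    · rintro ⟨Θ, hΘ, rfl⟩
      exact ⟨Θ, Finset.mem_powersetCard_univ.1 (Finset.mem_coe.1 hΘ), rfl⟩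
  refine (congrArg Set.encard h).trans (((subsetChannel_injective hA).encard_image _).trans ?_)
  rw [Set.encard_coe_eq_coe_finsetCard, Finset.card_powersetCard]
  simp

/-- With `k = ⌊2^(na)⌋`, the bounds `2^k ≤ choose ≤ 2^(nk)` squeeze the sequence between `a - 1/n`
and `a + (log₂ n)/n`. -/
theorem tendsto_logb_logb_choose (ha0 : 0 < a) (ha : a < 1) :
    Tendsto (fun n : ℕ => Real.logb 2 (Real.logb 2
      ((2 ^ n).choose ⌊(2 : ℝ) ^ (n * a)⌋₊ : ℕ)) / n) atTop (𝓝 a) := by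
  have hlow : Tendsto (fun n : ℕ => a - 1 / (n : ℝ)) atTop (𝓝 a) := by
    simpa using (tendsto_const_nhds (x := a)).sub
      (tendsto_one_div_atTop_nhds_zero_nat (𝕜 := ℝ))
  have hupp : Tendsto (fun n : ℕ => a + Real.logb 2 n / n) atTop (𝓝 a) := by
    simpa using (tendsto_const_nhds (x := a)).add tendsto_logb_two_div
  -- Gives `2 k ≤ 2 ^ n`, as `two_pow_le_choose` requires.
  have hlarge : ∀ᶠ n : ℕ in atTop, 1 ≤ (n : ℝ) * (1 - a) :=
    (tendsto_natCast_atTop_atTop.atTop_mul_const (sub_pos.2 ha)).eventually_ge_atTop 1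
  have hbounds : ∀ᶠ n : ℕ in atTop, 0 < (n : ℝ) ∧
      n * a - 1 ≤ Real.logb 2 (Real.logb 2 ((2 ^ n).choose ⌊(2 : ℝ) ^ (n * a)⌋₊ : ℕ)) ∧
      Real.logb 2 (Real.logb 2 ((2 ^ n).choose ⌊(2 : ℝ) ^ (n * a)⌋₊ : ℕ)) ≤
        n * a + Real.logb 2 n := by
    filter_upwards [hlarge, eventually_gt_atTop 0] with n hn hn0
    have hn0 : (0 : ℝ) < n := by exact_mod_cast hn0
    set k := ⌊(2 : ℝ) ^ (n * a)⌋₊ with hk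
    have hk0 : 0 < k := Nat.floor_pos.2 (Real.one_le_rpow (by norm_num) (by positivity))
    have hkle : (k : ℝ) ≤ (2 : ℝ) ^ (n * a) := Nat.floor_le (by positivity)
    have h2k : 2 * k ≤ 2 ^ n := by
      have : (2 * k : ℝ) ≤ (2 : ℝ) ^ n := by
        calc (2 * k : ℝ) ≤ (2 : ℝ) ^ (1 : ℝ) * (2 : ℝ) ^ (n * a) := by
              rw [Real.rpow_one]; linarith
          _ = (2 : ℝ) ^ (1 + n * a) := (Real.rpow_add (by norm_num) _ _).symm
          _ ≤ (2 : ℝ) ^ (n : ℝ) :=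
              Real.rpow_le_rpow_of_exponent_le (by norm_num) (by linarith)
          _ = (2 : ℝ) ^ n := Real.rpow_natCast _ _
      exact_mod_cast this
    set N := (2 ^ n).choose k with hN
    have hN1 : (2 : ℝ) ^ k ≤ N := by exact_mod_cast two_pow_le_choose hk0 h2k
    have hN0 : (0 : ℝ) < N := lt_of_lt_of_le (by positivity) hN1
    have hN2 : (N : ℝ) ≤ (2 : ℝ) ^ (n * k) := by
      rw [pow_mul]
      exact_mod_cast Nat.choose_le_pow (2 ^ n) k
    have hl1 : (k : ℝ) ≤ Real.logb 2 N := by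
      rw [Real.le_logb_iff_rpow_le (by norm_num) hN0, Real.rpow_natCast]
      exact hN1
    have hl2 : Real.logb 2 N ≤ n * k := by
      rw [Real.logb_le_iff_le_rpow (by norm_num) hN0]
      exact_mod_cast hN2
    have hl0 : 0 < Real.logb 2 N := lt_of_lt_of_le (by exact_mod_cast hk0) hl1
    refine ⟨hn0, ?_, ?_⟩
    · rw [Real.le_logb_iff_rpow_le (by norm_num) hl0, Real.rpow_sub (by norm_num), Real.rpow_one]
      exact (half_rpow_le_floor ha0 n).trans hl1
    · calc Real.logb 2 (Real.logb 2 N) ≤ Real.logb 2 ((2 : ℝ) ^ (n * a) * n) := by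
            refine Real.logb_le_logb_of_le (by norm_num) hl0 (hl2.trans ?_)
            rw [mul_comm]
            gcongr
        _ = n * a + Real.logb 2 n := by
            rw [Real.logb_mul (by positivity) hn0.ne', Real.logb_rpow (by norm_num) (by norm_num)]
  refine tendsto_of_tendsto_of_tendsto_of_le_of_le' hlow hupp ?_ ?_
  · filter_upwards [hbounds] with n hn
    rw [le_div_iff₀ hn.1, sub_mul, one_div, inv_mul_cancel₀ hn.1.ne']
    linarith [hn.2.1]
  · filter_upwards [hbounds] with n hn
    rw [div_le_iff₀ hn.1, add_mul, div_mul_cancel₀ _ hn.1.ne']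
    linarith [hn.2.2]

theorem subsetGAVWC_wiretapRate (ha0 : 0 < a) : (subsetGAVWC a ha).wiretapRate = a := by
  refine doubleExpRate_eq_of_tendsto ?_ (tendsto_logb_logb_choose ha0 ha)
  filter_upwards [eventually_gt_atTop 0] with n hn
  rw [subsetGAVWC_encard_wiretap ha hn, ENat.toENNReal_coe, logLog_natCast]

/-! ### The capacities in the example -/

/-- The code which sends all binary words uncoded. -/
def uncodedCode (a : ℝ) (ha : a < 1) (n : ℕ) : (subsetGAVWC a ha).Code n where
  M := Fintype.card (Fin n → Bool)
  M_pos := Fintype.card_pos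
  enc u := stdSimplex.vertex (X := Fin n → Bool) ((Fintype.equivFin (Fin n → Bool)).symm u)
  dec y := Fintype.equivFin (Fin n → Bool) y

theorem uncodedCode_rate {n : ℕ} (hn : 0 < n) : (uncodedCode a ha n).rate = 1 := by
  have h : ((uncodedCode a ha n).M : ℝ) = 2 ^ n := by simp [uncodedCode]
  have hn : (n : ℝ) ≠ 0 := by positivity
  rw [GAVWC.Code.rate, h, Real.logb_pow, Real.logb_self_eq_one (by norm_num), mul_one,
    div_self hn]

theorem uncodedCode_maximalError (n : ℕ) : (uncodedCode a ha n).MaximalError 0 := by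
  intro W hW u
  have hW : W = fun x : Fin n → Bool => stdSimplex.vertex x := hW
  refine ((uncodedCode a ha n).errorProb_eq_sum_ite W u).trans_le
    (Finset.sum_eq_zero fun y _ => ?_).le
  split_ifs with h
  · rfl
  · rw [hW]
    refine (outputProb_noiseless (A := Fin n → Bool) (uncodedCode a ha n).enc u y).trans ?_
    refine Pi.single_eq_of_ne (fun hy => h ?_) _
    exact (Equiv.symm_apply_eq _).1 hy.symm |>.symm

theorem uncodedCode_leakage (n : ℕ) (Θ : Finset (Fin n → Bool)) :
    (uncodedCode a ha n).leakage (subsetChannel (A := Fin n → Bool) Θ)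
      (fun _ => 1 / ((uncodedCode a ha n).M : ℝ)) =
    mutualInfo (fun _ : Fin n → Bool => 1 / (Fintype.card (Fin n → Bool) : ℝ))
      (fun x z => subsetChannel Θ x z) := by
  rw [← mutualInfo_comp_equiv (Fintype.equivFin (Fin n → Bool)).symm]
  refine congrArg (mutualInfo (U := Fin (Fintype.card (Fin n → Bool)))
    (B := Fin n → Bool) _) (funext fun u => funext fun z => ?_)
  exact outputProb_of_eq_vertex (A := Fin n → Bool) (Φ := (uncodedCode a ha n).enc)
    (subsetChannel Θ) (x := (Fintype.equivFin (Fin n → Bool)).symm u) rfl z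

/-- Uncoded transmission works: a fraction at most `r ^ n = 2^(-n(1-a))` of the inputs lies in `Θ`,
so the leakage is at most `n r^n + log₂ (1 / (1 - r^n))`. -/
theorem subsetGAVWC_achievableStrong_one : (subsetGAVWC a ha).AchievableStrong 1 := by
  refine ⟨zero_le_one, fun ε l m hε hl hm => ?_⟩
  set r : ℝ := (2 : ℝ) ^ (a - 1) with hr
  have hr0 : 0 < r := by positivity
  have hr1 : r < 1 := Real.rpow_lt_one_of_one_lt_of_neg (by norm_num) (by linarith)
  have hlim : Tendsto (fun n : ℕ => r ^ n * n + Real.logb 2 (1 / (1 - r ^ n))) atTop (𝓝 0) := by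
    have h1 : Tendsto (fun n : ℕ => r ^ n * n) atTop (𝓝 0) := by
      simpa [mul_comm] using tendsto_self_mul_const_pow_of_lt_one hr0.le hr1
    have h2 : Tendsto (fun n : ℕ => 1 / (1 - r ^ n)) atTop (𝓝 1) := by
      have := (tendsto_const_nhds (x := (1 : ℝ))).div
        ((tendsto_const_nhds (x := (1 : ℝ))).sub (tendsto_pow_atTop_nhds_zero_of_lt_one hr0.le hr1))
        (by norm_num)
      simp only [sub_zero, div_one] at this
      exact this
    have h3 := ((Real.continuousAt_logb (b := 2) (one_ne_zero)).tendsto.comp h2)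
    rw [Real.logb_one] at h3
    simpa using h1.add h3
  filter_upwards [hlim.eventually (gt_mem_nhds hm), eventually_gt_atTop 0] with n hn hn0
  refine ⟨uncodedCode a ha n, by rw [uncodedCode_rate ha hn0]; linarith,
    fun W hW => ((uncodedCode_maximalError ha n).averageError W hW).trans hl.le, ?_⟩
  rintro V ⟨Θ, hΘ, rfl⟩
  refine (uncodedCode_leakage ha n Θ).trans_le (le_trans ?_ hn.le)
  have hcard : (Fintype.card (Fin n → Bool) : ℝ) = 2 ^ n := by simp
  refine (mutualInfo_subsetChannel_le Θ (t := r ^ n) (pow_lt_one₀ hr0.le hr1 hn0.ne') ?_).trans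
    (le_of_eq ?_)
  · rw [hΘ, hcard]
    refine (Nat.floor_le (by positivity)).trans (le_of_eq ?_)
    rw [← mul_pow, hr, ← Real.rpow_add_one (by norm_num), ← Real.rpow_natCast,
      ← Real.rpow_mul (by norm_num)]
    congr 1
    ring
  · rw [hcard, Real.logb_pow, Real.logb_self_eq_one (by norm_num), mul_one]

theorem subsetGAVWC_capacityStrong : (subsetGAVWC a ha).capacityStrong = 1 := by
  refine le_antisymm ?_ ?_
  · refine (GAVWC.capacityStrong_le (c := 2) fun n => ?_).trans (le_of_eq ?_)
    · refine le_of_eq ?_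
      change Fintype.card (Fin n → Bool) = 2 ^ n
      simp
    · simp
  · exact le_iSup₂_of_le
      (f := fun (R : ℝ) (_ : (subsetGAVWC a ha).AchievableStrong R) => (R : EReal)) 1
      (subsetGAVWC_achievableStrong_one ha) (by simp)

/-- If there are many messages, then two of them have small decoding sets. -/
theorem exists_pair_small_fibers {Y U : Type} [Fintype Y] [Fintype U] [DecidableEq U]
    (f : Y → U) {k : ℕ} (h : 2 * Fintype.card Y < (Fintype.card U - 1) * k) :
    ∃ u v, u ≠ v ∧ (Finset.univ.filter fun y => f y = u).card +
      (Finset.univ.filter fun y => f y = v).card ≤ k := by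
  by_contra! hcon
  have hsum : ∑ u, (Finset.univ.filter fun y => f y = u).card = Fintype.card Y :=
    (Finset.card_eq_sum_card_fiberwise (f := f)
      (fun _ _ => Finset.mem_coe.2 (Finset.mem_univ _))).symm
  -- At most one fibre is smaller than `k / 2`, since two of them would form the desired pair. The
  -- remaining `|U| - 1` fibres then exhaust more than `Y` has.
  have hone : ∃ u₀ : U, ∀ u, u ≠ u₀ → k ≤ 2 * (Finset.univ.filter fun y => f y = u).card := by
    by_cases hex : ∃ u₀ : U, 2 * (Finset.univ.filter fun y => f y = u₀).card < k
    · obtain ⟨u₀, hu₀⟩ := hex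
      refine ⟨u₀, fun u hu => ?_⟩
      have := hcon u u₀ hu
      omega
    · push Not at hex
      have : Nonempty U := by
        by_contra hU
        rw [not_nonempty_iff] at hU
        simp at h
      exact ⟨Classical.arbitrary U, fun u _ => hex u⟩
  obtain ⟨u₀, hu₀⟩ := hone
  have h1 : (Fintype.card U - 1) * k ≤ 2 * Fintype.card Y := by
    rw [← hsum, Finset.mul_sum]
    calc (Fintype.card U - 1) * k = ∑ u ∈ Finset.univ.erase u₀, k := by
          rw [Finset.sum_const, Finset.card_erase_of_mem (Finset.mem_univ _), Finset.card_univ,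
            smul_eq_mul]
      _ ≤ ∑ u ∈ Finset.univ.erase u₀, 2 * (Finset.univ.filter fun y => f y = u).card :=
          Finset.sum_le_sum fun u hu => hu₀ u (Finset.ne_of_mem_erase hu)
      _ ≤ _ := Finset.sum_le_sum_of_subset (Finset.erase_subset _ _)
  omega

/-- A code for the subset channels with many messages leaks information on some pair of
messages. -/
theorem not_miSecure_of_maximalError {n : ℕ} (c : (subsetGAVWC a ha).Code n)
    (hM : 2 * 2 ^ n < (c.M - 1) * ⌊(2 : ℝ) ^ (n * a)⌋₊) (he : c.MaximalError (1 / 20)) :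
    ¬ c.MISecure (1 / 20) := by
  intro hsec
  let dec : (Fin n → Bool) → Fin c.M := c.dec
  let enc : Channel (Fin c.M) (Fin n → Bool) := c.enc
  obtain ⟨u, v, huv, hk⟩ := exists_pair_small_fibers dec
    (k := ⌊(2 : ℝ) ^ (n * a)⌋₊) (by simpa using hM)
  set D : Fin c.M → Finset (Fin n → Bool) := fun u => Finset.univ.filter fun y => dec y = u
    with hD
  -- The jammer makes both decoding sets transparent, padding to the exact size that the family
  -- prescribes.
  obtain ⟨Θ, hDΘ, hΘ⟩ := Finset.exists_superset_card_eq (s := D u ∪ D v)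
    (n := ⌊(2 : ℝ) ^ (n * a)⌋₊) ((Finset.card_union_le _ _).trans hk)
    (by simpa using floor_two_rpow_le a ha n)
  have hdec : ∀ w, 19 / 20 ≤ ∑ y ∈ D w, enc w y := by
    intro w
    have h1 := (c.errorProb_eq_sum_ite _ w).symm.trans_le
      (he (fun x => stdSimplex.vertex (X := Fin n → Bool) x) rfl w)
    have h2 : ∑ y : Fin n → Bool, (if dec y = w then 0 else enc w y) ≤ 1 / 20 := by
      refine le_trans (le_of_eq (Finset.sum_congr rfl fun y _ => ?_)) h1
      exact congrArg (fun t : ℝ => if dec y = w then 0 else t)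
        (outputProb_noiseless (A := Fin n → Bool) enc w y).symm
    have h3 : ∑ y ∈ D w, enc w y + ∑ y : Fin n → Bool, (if dec y = w then 0 else enc w y) = 1 := by
      rw [hD, Finset.sum_filter, ← Finset.sum_add_distrib, ← stdSimplex.sum_eq_one (enc w)]
      refine Finset.sum_congr rfl fun y _ => ?_
      split_ifs <;> simp
    linarith
  -- Codewords in `D w` pass unchanged; inputs outside `Θ` can only add mass to `D w`.
  have hout : ∀ w, D w ⊆ Θ → 19 / 20 ≤ ∑ z ∈ D w, outputProb enc (subsetChannel Θ) w z := by
    intro w hw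
    refine (hdec w).trans (Finset.sum_le_sum fun z hz => ?_)
    have h1 := Finset.single_le_sum (f := fun x => enc w x * subsetChannel Θ x z)
      (fun x _ => mul_nonneg (stdSimplex.zero_le (enc w) x)
        (stdSimplex.zero_le (subsetChannel Θ x) z)) (Finset.mem_univ z)
    have h2 : enc w z * subsetChannel Θ z z = enc w z := by
      rw [subsetChannel_of_mem (hw hz), if_pos rfl, mul_one]
    exact h2.symm.trans_le h1
  have hu := hout u (Finset.subset_union_left.trans hDΘ)
  have hv := hout v (Finset.subset_union_right.trans hDΘ)
  have hdisj : Disjoint (D u) (D v) := by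
    rw [Finset.disjoint_left]
    intro y hyu hyv
    simp only [hD, Finset.mem_filter] at hyu hyv
    exact huv (hyu.2.symm.trans hyv.2)
  have hv' : ∑ z ∈ D u, outputProb enc (subsetChannel Θ) v z ≤ 1 / 20 := by
    have h1 : ∑ z ∈ D u ∪ D v, outputProb enc (subsetChannel Θ) v z ≤ 1 := by
      rw [← sum_outputProb enc (subsetChannel Θ) v]
      exact Finset.sum_le_sum_of_subset_of_nonneg (Finset.subset_univ _)
        fun z _ _ => outputProb_nonneg _ _ _ z
    rw [Finset.sum_union hdisj] at h1
    linarith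
  have h := lt_mutualInfo_pairDist (outputProb_nonneg enc (subsetChannel Θ))
    (sum_outputProb enc (subsetChannel Θ)) u v (D u) hu hv'
  exact absurd (hsec (subsetChannel (A := Fin n → Bool) Θ) ⟨Θ, hΘ, rfl⟩ _ (pairDist_mem u v)) (not_le.2 h)

theorem subsetGAVWC_achievableMI_le (ha0 : 0 < a) {R : ℝ}
    (hR : (subsetGAVWC a ha).AchievableMI R) : R ≤ 1 - a := by
  by_contra! hlt
  set ε := (R - (1 - a)) / 2 with hε
  have hε0 : 0 < ε := by rw [hε]; linarith
  have hq : 1 < (2 : ℝ) ^ ε := Real.one_lt_rpow (by norm_num) hε0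
  -- The `8` absorbs the factor `2` in the pigeonhole bound and the two factors `1/2` lost in `M - 1
  -- ≥ M / 2` and in the floor.
  obtain ⟨n, ⟨c, hrate, herr, hsec⟩, hn, hn0⟩ := ((hR.2 ε (1 / 20) (1 / 20) hε0 (by norm_num)
    (by norm_num)).and (((tendsto_pow_atTop_atTop_of_one_lt hq).eventually_gt_atTop 8).and
      (eventually_gt_atTop 0))).exists
  refine not_miSecure_of_maximalError ha c ?_ herr hsec
  have hn0 : (0 : ℝ) < n := by exact_mod_cast hn0
  have hM : (2 : ℝ) ^ (n * (1 - a + ε)) < c.M := by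
    rw [← Real.lt_logb_iff_rpow_lt (by norm_num) c.M_pos']
    rw [GAVWC.Code.rate, lt_div_iff₀ hn0] at hrate
    have : R - ε = 1 - a + ε := by rw [hε]; ring
    rw [this] at hrate
    linarith
  have hM2 : (2 : ℝ) ≤ c.M := by
    have h1 : 1 < (2 : ℝ) ^ (n * (1 - a + ε)) :=
      Real.one_lt_rpow (by norm_num) (mul_pos hn0 (by linarith))
    have h2 : 1 < c.M := by exact_mod_cast h1.trans hM
    exact_mod_cast h2
  have hk := half_rpow_le_floor ha0 n
  have hprod : (2 : ℝ) ^ (n * (1 - a + ε)) * (2 : ℝ) ^ (n * a) = 2 ^ n * ((2 : ℝ) ^ ε) ^ n := by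
    rw [← Real.rpow_add (by norm_num), ← Real.rpow_natCast, ← Real.rpow_natCast,
      ← Real.rpow_mul (by norm_num), ← Real.rpow_add (by norm_num)]
    congr 1
    ring
  have hreal : (2 * 2 ^ n : ℝ) < (c.M - 1) * (⌊(2 : ℝ) ^ (n * a)⌋₊ : ℝ) := by
    calc (2 * 2 ^ n : ℝ) = 2 ^ n * 8 / 4 := by ring
      _ < 2 ^ n * ((2 : ℝ) ^ ε) ^ n / 4 := by gcongr
      _ = (2 : ℝ) ^ (n * (1 - a + ε)) / 2 * ((2 : ℝ) ^ (n * a) / 2) := by rw [← hprod]; ring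
      _ ≤ (c.M - 1) * (⌊(2 : ℝ) ^ (n * a)⌋₊ : ℝ) := by
          refine mul_le_mul ?_ hk (by positivity) (by linarith)
          linarith
  have hcast : ((c.M - 1 : ℕ) : ℝ) = c.M - 1 := by
    rw [Nat.cast_sub c.M_pos, Nat.cast_one]
  rw [← hcast] at hreal
  exact_mod_cast hreal

theorem max_mainRate_wiretapRate_subsetGAVWC (ha0 : 0 < a) :
    max (subsetGAVWC a ha).mainRate (subsetGAVWC a ha).wiretapRate = a := by
  rw [subsetGAVWC_mainRate, subsetGAVWC_wiretapRate ha ha0]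
  exact max_eq_right (by exact_mod_cast ha0.le)

/-- No code is constructed for the lower bound: the general inequality, with strong capacity `1` and
right-hand side `a`, forces it. -/
theorem subsetGAVWC_capacityMI (ha0 : 0 < a) :
    (subsetGAVWC a ha).capacityMI = ((1 - a : ℝ) : EReal) := by
  refine le_antisymm
    (iSup₂_le fun R hR => EReal.coe_le_coe_iff.2 (subsetGAVWC_achievableMI_le ha ha0 hR)) ?_
  have h := (subsetGAVWC a ha).capacityStrong_sub_capacityMI_le
  rw [max_mainRate_wiretapRate_subsetGAVWC ha ha0, subsetGAVWC_capacityStrong] at h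
  have htop := (subsetGAVWC a ha).capacityMI_ne_top
  have hbot : (subsetGAVWC a ha).capacityMI ≠ ⊥ :=
    (lt_of_lt_of_le (by simp) (subsetGAVWC a ha).capacityMI_nonneg).ne'
  lift (subsetGAVWC a ha).capacityMI to ℝ using ⟨htop, hbot⟩ with x
  rw [← EReal.coe_one, ← EReal.coe_sub, EReal.coe_le_coe_iff] at h
  exact EReal.coe_le_coe_iff.2 (by linarith)

end Example

end

theorem theorem3 :
    (∀ G : GAVWC, G.minProbRate = 0 →
      G.capacityStrong ≠ ⊤ ∧ G.capacityMI ≠ ⊤ ∧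
      G.capacityStrong - G.capacityMI ≤ max G.mainRate G.wiretapRate) ∧
    (∀ (a : ℝ) (_ : 0 < a) (ha : a < 1),
      (subsetGAVWC a ha).minProbRate = 0 ∧
      (subsetGAVWC a ha).capacityStrong = 1 ∧
      (subsetGAVWC a ha).capacityMI = ((1 - a : ℝ) : EReal) ∧
      max (subsetGAVWC a ha).mainRate (subsetGAVWC a ha).wiretapRate = (a : EReal) ∧
      (subsetGAVWC a ha).capacityStrong - (subsetGAVWC a ha).capacityMI =
        max (subsetGAVWC a ha).mainRate (subsetGAVWC a ha).wiretapRate) :=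
  ⟨fun G _ => ⟨G.capacityStrong_ne_top, G.capacityMI_ne_top, G.capacityStrong_sub_capacityMI_le⟩,
    fun a ha0 ha => by
      refine ⟨subsetGAVWC_minProbRate ha, subsetGAVWC_capacityStrong ha,
        subsetGAVWC_capacityMI ha ha0, max_mainRate_wiretapRate_subsetGAVWC ha ha0, ?_⟩
      rw [subsetGAVWC_capacityStrong ha, subsetGAVWC_capacityMI ha ha0,
        max_mainRate_wiretapRate_subsetGAVWC ha ha0, ← EReal.coe_one, ← EReal.coe_sub]
      congr 1
      ring⟩
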